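/- A rooted plane curve with \(n\ge 1\) crossings is a triple \((\sigma,\tau,a)\) consisting of two permutations \(\sigma,\tau\) of a set of \(4n\) flags and a root flag \(a\), considered up to relabelling of the flags, such that \(\sigma\) is a product of \(n\) disjoint \(4\)-cycles (the vertices), \(\tau\) is a product of \(2n\) disjoint transpositions (the edges), the group generated by \(\sigma\) and \(\tau\) acts transitively on the flags (connectedness), \(\sigma\tau\) has exactly \(n+2\) cycles, fixed points included (planarity), and \(\sigma^2\tau\) has exactly two cycles (the map is traced by a single closed curve, one cycle for each orientation). The cycles of \(\sigma\tau\) are the faces of the curve, and the degree of a face is the length of its cycle. **Theorem.** Let \(p_{n,k}\) denote the probability that a uniformly random face of a uniformly random rooted plane curve with \(n\) crossings has degree \(k\). Let \(k\ge 1\). Then, for every \(n\ge1\), \((n+2)\,p_{n,k}\) is the expected number of faces of degree \(k\) of a uniformly random rooted plane curve with \(n\) crossings, and \[ 0<\liminf_{n\to\infty}p_{n,k}\le\limsup_{n\to\infty}p_{n,k}<1 . \] -/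

import Mathlib

open Filter
open scoped BigOperators

/-- A plane curve with `n` vertices whose `4 n` flags are labelled by `Fin (4 * n)`, together with
a root flag, given as a combinatorial map: `σ` permutes the four flags around each vertex
counterclockwise, and `τ` exchanges the two flags of each edge.

For a permutation `π` of a finite type, `π.partition.parts` is the multiset of the lengths of
*all* cycles of `π`, fixed points included (as cycles of length one). -/
structure LabelledCurve (n : ℕ) where
  /-- the vertex permutation -/
  σ : Equiv.Perm (Fin (4 * n))
  /-- the edge permutation -/
  τ : Equiv.Perm (Fin (4 * n))
  /-- the root flag, that is, an edge with a direction -/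
  root : Fin (4 * n)
  /-- `σ` is a product of `n` disjoint cycles of length 4 -/
  vertices : σ.cycleType = Multiset.replicate n 4
  /-- `τ` is a product of `2 n` disjoint cycles of length 2 -/
  edges : τ.cycleType = Multiset.replicate (2 * n) 2
  /-- the underlying graph is connected -/
  connected : MulAction.IsPretransitive (Subgroup.closure {σ, τ}) (Fin (4 * n))
  /-- planarity (Euler's formula): there are `n + 2` faces, the faces being the cycles of `σ τ` -/
  planar : Multiset.card (σ * τ).partition.parts = n + 2
  /-- the map is traced by a single closed curve: `σ² τ` has exactly two cycles, one for each
  orientation of the curve -/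
  curve : Multiset.card (σ ^ 2 * τ).partition.parts = 2

namespace LabelledCurve

/-- Two labelled rooted plane curves are the same rooted plane curve if a relabelling of the flags
carries the vertices, edges and root of one to those of the other. -/
def Iso {n : ℕ} (C D : LabelledCurve n) : Prop :=
  ∃ g : Equiv.Perm (Fin (4 * n)),
    D.σ = g * C.σ * g⁻¹ ∧ D.τ = g * C.τ * g⁻¹ ∧ D.root = g C.root

instance setoid (n : ℕ) : Setoid (LabelledCurve n) where
  r := Iso
  iseqv :=
    { refl := fun C => ⟨1, by simp, by simp, by simp⟩
      symm := by
        rintro C D ⟨g, h1, h2, h3⟩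
        refine ⟨g⁻¹, ?_, ?_, ?_⟩
        · rw [h1]; group
        · rw [h2]; group
        · rw [h3]; simp
      trans := by
        rintro C D E ⟨g, h1, h2, h3⟩ ⟨h, k1, k2, k3⟩
        refine ⟨h * g, ?_, ?_, ?_⟩
        · rw [k1, h1]; group
        · rw [k2, h2]; group
        · rw [k3, h3]; simp }

instance finite (n : ℕ) : Finite (LabelledCurve n) :=
  Finite.of_injective
    (fun C : LabelledCurve n => (C.σ, C.τ, C.root)) (by
      rintro ⟨σ, τ, r, _⟩ ⟨σ', τ', r', _⟩ h
      simp only [Prod.mk.injEq] at h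
      obtain ⟨rfl, rfl, rfl⟩ := h
      rfl)

/-- The multiset of the degrees of the faces: the lengths of all cycles of `σ τ`. -/
def faceDegrees {n : ℕ} (C : LabelledCurve n) : Multiset ℕ := (C.σ * C.τ).partition.parts

theorem faceDegrees_eq {n : ℕ} {C D : LabelledCurve n} (h : Iso C D) :
    C.faceDegrees = D.faceDegrees := by
  obtain ⟨g, h1, h2, -⟩ := h
  unfold faceDegrees
  have hc : IsConj (C.σ * C.τ) (D.σ * D.τ) := by
    rw [isConj_iff]
    exact ⟨g, by rw [h1, h2]; group⟩
  rw [Equiv.Perm.partition_eq_of_isConj.1 hc]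

end LabelledCurve

/-- The rooted plane curves with `n` vertices (crossings). -/
def RootedPlaneCurve (n : ℕ) : Type := Quotient (LabelledCurve.setoid n)

namespace RootedPlaneCurve

instance finite (n : ℕ) : Finite (RootedPlaneCurve n) :=
  inferInstanceAs (Finite (Quotient (LabelledCurve.setoid n)))

noncomputable instance fintype (n : ℕ) : Fintype (RootedPlaneCurve n) := Fintype.ofFinite _

/-- The multiset of the degrees of the faces of a rooted plane curve. -/
def faceDegrees {n : ℕ} (D : RootedPlaneCurve n) : Multiset ℕ :=
  Quotient.lift LabelledCurve.faceDegrees (fun _ _ h => LabelledCurve.faceDegrees_eq h) D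

/-- The number of faces of degree `k`. -/
def faceCount {n : ℕ} (D : RootedPlaneCurve n) (k : ℕ) : ℕ := D.faceDegrees.count k

/-- The total number of faces. -/
def numFaces {n : ℕ} (D : RootedPlaneCurve n) : ℕ := Multiset.card D.faceDegrees

/-- The expected number of faces of degree `k` of a uniformly random rooted plane curve with `n`
crossings. -/
noncomputable def expectedFaceCount (n k : ℕ) : ℝ :=
  Finset.expect Finset.univ fun D : RootedPlaneCurve n => (D.faceCount k : ℝ)

/-- The probability that a uniformly random face of a uniformly random rooted plane curve with `n`
crossings has degree `k`: the average over all curves of the proportion of faces of degree `k`. -/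
noncomputable def faceProb (n k : ℕ) : ℝ :=
  Finset.expect Finset.univ fun D : RootedPlaneCurve n => (D.faceCount k : ℝ) / (D.numFaces : ℝ)

end RootedPlaneCurve

/-! Everything reduces to a lower bound: the proportions of faces of degrees `k` and `k + 1` add up
to at most one, so bounding every degree below also keeps the limsup under one.

The lower bound comes from surgery. Fix `σ` and count pairs of an edge permutation and a marked
flag. From a curve with a marked face of degree `j`, remove a crossing far from that face so that a
single plane curve remains, and reinsert it as a kink on an edge of the marked face, whose degree
becomes `j + 1`. The kink also creates a face of degree one, which starts the induction. There are
at least `n / 624` choices of the removed flag, and a removal is undone by one of `4 n` flags and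
one of 13 symbols (`Code`). Hence each step costs only a constant factor (`card_le_of_transfer`,
`card_isCurve_le`).

Removable crossings abound (`IsCurve.le_card_detachable`) because the inverse face degrees, summed
over all flags, give the number `n + 2` of faces, more than one per crossing. At each crossing, the
smoothing that disagrees with the orientation keeps the curve in one piece. By Euler's inequality
(`Turns.numCycles_le`) the two opposite corners that it merges lie in different faces. If one of
these has degree at most 12, the crossing is smoothed away, and a flag and a short distance along
the merged face tell how to undo this. A crossing with a loop is removed by straightening the loop.
A crossing between two opposite bigons is removed by pulling the two strands apart, which frees a
second crossing, put back as a kink. A crossing where nothing applies has inverse degrees of sum at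
most `1/13 + 1/13 + 1/2 + 1/3 < 1`.

Finally, relabellings act freely on rooted curves, so labelled curves may be counted instead. -/

namespace PlaneCurve

open Equiv Equiv.Perm

/-! ### Cycle counts under multiplication by a transposition -/

section Cycles

variable {F : Type*}

/-- The number of cycles of a permutation, fixed points included. -/
noncomputable def numCycles (φ : Perm F) : ℕ := Nat.card (Quotient (SameCycle.setoid φ))

theorem SameCycle.apply_eq_of_invariant {φ : Perm F} {β : Type*} {f : F → β}
    (hf : ∀ x, f (φ x) = f x) {x y : F} (h : SameCycle φ x y) : f x = f y := by
  obtain ⟨k, rfl⟩ := h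
  have hn : ∀ (m : ℕ) (x : F), f ((φ ^ m) x) = f x := by
    intro m
    induction m with
    | zero => simp
    | succ m ih => intro x; rw [pow_succ', Perm.mul_apply, hf, ih]
  cases k with
  | ofNat m => simpa using (hn m x).symm
  | negSucc m =>
    have := hn (m + 1) ((φ ^ (Int.negSucc m)) x)
    rw [zpow_negSucc] at this
    simpa using this

/-- The basic device for bounding cycle counts from below: an invariant function factors through the
cycles. -/
theorem card_le_numCycles [Finite F] {φ : Perm F} {β : Type*} (f : F → β)
    (hf : ∀ x, f (φ x) = f x) (hs : Function.Surjective f) : Nat.card β ≤ numCycles φ :=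
  Nat.card_le_card_of_surjective
    (Quotient.lift f fun _ _ h => SameCycle.apply_eq_of_invariant hf h)
    (fun b => by obtain ⟨x, rfl⟩ := hs b; exact ⟨Quotient.mk _ x, rfl⟩)

theorem mk_apply (φ : Perm F) (z : F) :
    (Quotient.mk (SameCycle.setoid φ) (φ z)) = Quotient.mk (SameCycle.setoid φ) z :=
  Quotient.sound (s := SameCycle.setoid φ) (sameCycle_apply_left.2 (SameCycle.refl φ z))

variable [DecidableEq F]

theorem swap_mul_invariant {φ : Perm F} {β : Type*} {f : F → β} {x y : F} (hf : ∀ z, f (φ z) = f z)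
    (hxy : f x = f y) (z : F) : f ((swap x y * φ) z) = f z := by
  rw [Perm.mul_apply, swap_apply_def]
  split_ifs with h1 h2
  · rw [← hxy, ← h1, hf]
  · rw [hxy, ← h2, hf]
  · exact hf z

theorem numCycles_le_swap_mul_of_sameCycle [Finite F] {φ : Perm F} {x y : F}
    (h : SameCycle φ x y) : numCycles φ ≤ numCycles (swap x y * φ) :=
  card_le_numCycles (Quotient.mk (SameCycle.setoid φ))
    (swap_mul_invariant (mk_apply φ) (Quotient.sound h)) Quotient.mk_surjective

/-- A transposition merges at most two cycles: the class map that identifies the cycles of `x` and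
`y` stays invariant, and its range is only one class smaller. -/
theorem numCycles_le_swap_mul [Finite F] (φ : Perm F) (x y : F) :
    numCycles φ ≤ numCycles (swap x y * φ) + 1 := by
  classical
  by_cases h : SameCycle φ x y
  · exact (numCycles_le_swap_mul_of_sameCycle h).trans (Nat.le_succ _)
  have hne : Quotient.mk (SameCycle.setoid φ) x ≠ Quotient.mk (SameCycle.setoid φ) y :=
    fun hxy => h (Quotient.exact hxy)
  let m : F → {c : Quotient (SameCycle.setoid φ) // c ≠ Quotient.mk _ y} := fun z =>
    if hz : Quotient.mk (SameCycle.setoid φ) z = Quotient.mk _ y then ⟨Quotient.mk _ x, hne⟩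
    else ⟨Quotient.mk _ z, hz⟩
  have key : Nat.card {c : Quotient (SameCycle.setoid φ) // c ≠ Quotient.mk _ y}
      ≤ numCycles (swap x y * φ) := by
    refine card_le_numCycles m (swap_mul_invariant (fun z => ?_) ?_) ?_
    · simp only [m, mk_apply]
    · simp [m, hne]
    · rintro ⟨c, hc⟩
      induction c using Quotient.inductionOn with
      | _ z => exact ⟨z, by simp [m, hc]⟩
  have : Nat.card {c : Quotient (SameCycle.setoid φ) // c ≠ Quotient.mk _ y} + 1
      = numCycles φ := by
    unfold numCycles
    have := Fintype.ofFinite (Quotient (SameCycle.setoid φ))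
    rw [Nat.card_eq_fintype_card, Nat.card_eq_fintype_card, Fintype.card_subtype_compl,
      Fintype.card_subtype_eq]
    have : 0 < Fintype.card (Quotient (SameCycle.setoid φ)) :=
      Fintype.card_pos_iff.2 ⟨Quotient.mk _ y⟩
    omega
  omega

/-- `p` becomes a fixed point, while the rest of its cycle is nonempty because `φ p ≠ p`. -/
theorem numCycles_succ_le_swap_mul [Finite F] {φ : Perm F} {p : F} (hp : φ p ≠ p) :
    numCycles φ + 1 ≤ numCycles (swap p (φ p) * φ) := by
  classical
  have key : Nat.card (Option (Quotient (SameCycle.setoid φ)))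
      ≤ numCycles (swap p (φ p) * φ) := by
    refine card_le_numCycles
      (fun z => if z = p then none else some (Quotient.mk (SameCycle.setoid φ) z)) ?_ ?_
    · intro z
      by_cases hz : z = p
      · subst hz; simp
      · have h2 : φ z ≠ φ p := fun h => hz (φ.injective h)
        rw [Perm.mul_apply, swap_apply_def]
        by_cases h1 : φ z = p
        · have : Quotient.mk (SameCycle.setoid φ) (φ p) = Quotient.mk (SameCycle.setoid φ) z := by
            rw [mk_apply, ← h1, mk_apply]
          simp [h1, hz, hp, this]
        · simp [h1, hz, h2, mk_apply]
    · rintro (_ | c)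
      · exact ⟨p, by simp⟩
      · induction c using Quotient.inductionOn with
        | _ z =>
          by_cases hz : z = p
          · exact ⟨φ p, by simp [hp, hz, mk_apply]⟩
          · exact ⟨z, by simp [hz]⟩
  rwa [Finite.card_option] at key

end Cycles

/-! ### Single closed curves as joint orbits of two pairings -/

section Joined

variable {F : Type*}

/-- Every property of flags in `A` that `s` and `τ` preserve holds for all or for none. -/
def JoinedOn (A : Set F) (s τ : F → F) : Prop :=
  ∀ f : F → Prop, (∀ x ∈ A, (f (s x) ↔ f x)) → (∀ x ∈ A, (f (τ x) ↔ f x)) →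
    ∀ x ∈ A, ∀ y ∈ A, f x → f y

/-- A fixed-point-free involution. -/
def IsPairing (τ : Perm F) : Prop := ∀ x, τ x ≠ x ∧ τ (τ x) = x

theorem IsPairing.inv {τ : Perm F} (h : IsPairing τ) : τ⁻¹ = τ := by
  ext x; rw [Perm.inv_eq_iff_eq]; exact (h x).2.symm

theorem IsPairing.conj {τ : Perm F} (h : IsPairing τ) (g : Perm F) : IsPairing (g * τ * g⁻¹) := by
  intro x
  constructor
  · simp only [Perm.mul_apply]
    intro hx
    exact (h (g⁻¹ x)).1 (by rw [← Perm.eq_inv_iff_eq] at hx; exact hx)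
  · simp [(h _).2]

theorem IsPairing.conj_zpow {s τ : Perm F} (hs : IsPairing s) (hτ : IsPairing τ) (k : ℤ) (x : F) :
    τ (((s * τ) ^ k) x) = ((s * τ) ^ (-k)) (τ x) := by
  have h : τ * (s * τ) * τ⁻¹ = (s * τ)⁻¹ := by
    rw [mul_inv_rev, hs.inv, hτ.inv]
    ext x; simp [(hτ _).2]
  have h2 : τ * (s * τ) ^ k * τ⁻¹ = (s * τ) ^ (-k) := by
    rw [← _root_.conj_zpow, h, inv_zpow']
  rw [← h2]; simp

/-- `τ` conjugates `s * τ` to its inverse, so a path from `x` to `τ x` inside a cycle would have a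
midpoint fixed by `τ` or, for odd length, by `s`. -/
theorem IsPairing.not_sameCycle {s τ : Perm F} (hs : IsPairing s) (hτ : IsPairing τ) (x : F) :
    ¬ SameCycle (s * τ) x (τ x) := by
  rintro ⟨k, hk⟩
  rcases Int.even_or_odd' k with ⟨j, rfl | rfl⟩
  · apply (hτ (((s * τ) ^ j) x)).1
    rw [hs.conj_zpow hτ, ← hk, ← Perm.mul_apply, ← zpow_add]
    congr 2; ring
  · apply (hs (((s * τ) ^ (j + 1)) x)).1
    have : s (((s * τ) ^ (j + 1)) x) = (s * τ) (τ (((s * τ) ^ (j + 1)) x)) := by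
      simp [(hτ _).2]
    rw [this, hs.conj_zpow hτ, ← hk, ← Perm.mul_apply, ← Perm.mul_apply, ← zpow_one_add,
      ← zpow_add]
    congr 2; ring

theorem JoinedOn.sameCycle_or {s τ : Perm F} (hs : IsPairing s) (hτ : IsPairing τ)
    (h : JoinedOn Set.univ s τ) (x y : F) :
    SameCycle (s * τ) x y ∨ SameCycle (s * τ) (τ x) y := by
  have key : ∀ a b : F, SameCycle (s * τ) a b → SameCycle (s * τ) (τ a) (τ b) := by
    rintro a b ⟨k, rfl⟩
    rw [hs.conj_zpow hτ]
    exact ⟨-k, rfl⟩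
  have hτi : ∀ z, (SameCycle (s * τ) x (τ z) ∨ SameCycle (s * τ) (τ x) (τ z)) ↔
      (SameCycle (s * τ) x z ∨ SameCycle (s * τ) (τ x) z) := by
    intro z
    constructor
    · rintro (h | h)
      · right; simpa [(hτ z).2] using key _ _ h
      · left; simpa [(hτ z).2, (hτ x).2] using key _ _ h
    · rintro (h | h)
      · right; exact key _ _ h
      · left; simpa [(hτ x).2] using key _ _ h
  refine h (fun y => SameCycle (s * τ) x y ∨ SameCycle (s * τ) (τ x) y) (fun z _ => ?_)
    (fun z _ => hτi z) x trivial y trivial (Or.inl (SameCycle.refl _ _))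
  have : s z = (s * τ) (τ z) := by simp [(hτ z).2]
  rw [this, sameCycle_apply_right, sameCycle_apply_right]
  exact hτi z

/-- The two cycles of `s * τ` are the two directions of the curve, exchanged by both `s` and `τ`;
`o` is the direction through `x`. -/
theorem JoinedOn.exists_orientation {s τ : Perm F} (hs : IsPairing s) (hτ : IsPairing τ)
    (h : JoinedOn Set.univ s τ) (x : F) :
    ∃ o : F → Prop, (∀ z, o (s z) ↔ ¬ o z) ∧ (∀ z, o (τ z) ↔ ¬ o z) ∧
      ∀ z, (SameCycle (s * τ) x z ↔ o z) := by
  have hτo : ∀ z, SameCycle (s * τ) x (τ z) ↔ ¬ SameCycle (s * τ) x z := by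
    intro z
    constructor
    · intro h1 h2
      exact hs.not_sameCycle hτ z (h2.symm.trans h1)
    · intro h1
      rcases h.sameCycle_or hs hτ z x with h2 | h2
      · exact absurd h2.symm h1
      · exact h2.symm
  refine ⟨fun z => SameCycle (s * τ) x z, fun z => ?_, hτo, fun _ => Iff.rfl⟩
  have : s z = (s * τ) (τ z) := by simp [(hτ z).2]
  change SameCycle (s * τ) x (s z) ↔ ¬ SameCycle (s * τ) x z
  rw [this, sameCycle_apply_right]
  exact hτo z

/-- This translates the cycle count into `JoinedOn`, which also makes sense on the complement of a
detached crossing. -/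
theorem joinedOn_univ_iff_numCycles [Finite F] [Nonempty F] {s τ : Perm F} (hs : IsPairing s)
    (hτ : IsPairing τ) : JoinedOn Set.univ s τ ↔ numCycles (s * τ) = 2 := by
  constructor
  · intro h
    obtain ⟨x⟩ := ‹Nonempty F›
    unfold numCycles
    rw [Nat.card_eq_two_iff]
    refine ⟨Quotient.mk _ x, Quotient.mk _ (τ x),
      fun hx => hs.not_sameCycle hτ x (Quotient.exact hx),
      Set.eq_univ_of_forall fun c => ?_⟩
    induction c using Quotient.inductionOn with
    | _ z =>
      rcases h.sameCycle_or hs hτ x z with h1 | h1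
      · exact Or.inl (Quotient.sound (s := SameCycle.setoid (s * τ)) h1.symm)
      · exact Or.inr (Quotient.sound (s := SameCycle.setoid (s * τ)) h1.symm)
  · intro h f hfs hfτ x _ y _ hx
    unfold numCycles at h
    rw [Nat.card_eq_two_iff' (Quotient.mk (SameCycle.setoid (s * τ)) x)] at h
    have hc : ∀ z, f ((s * τ) z) = f z := fun z => propext ((hfs _ trivial).trans (hfτ _ trivial))
    by_cases hy : SameCycle (s * τ) x y
    · rwa [← SameCycle.apply_eq_of_invariant hc hy]
    · have h1 : Quotient.mk (SameCycle.setoid (s * τ)) y ≠ Quotient.mk _ x :=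
        fun h => hy (Quotient.exact h).symm
      have h2 : Quotient.mk (SameCycle.setoid (s * τ)) (τ x) ≠ Quotient.mk _ x :=
        fun h => hs.not_sameCycle hτ x (Quotient.exact h).symm
      have h3 : SameCycle (s * τ) (τ x) y := Quotient.exact (h.unique h2 h1)
      rw [← SameCycle.apply_eq_of_invariant hc h3, hfτ _ trivial]
      exact hx

/-- Joining two flags of equal orientation only reverses one of the two arcs between the visits to
the crossing, so the curve stays in one piece. -/
theorem joinedOn_smoothing [Finite F] {s s' τ : Perm F} (hs : IsPairing s)
    (h : JoinedOn Set.univ s τ) {o : F → Prop} (hos : ∀ z, o (s z) ↔ ¬ o z)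
    (hoτ : ∀ z, o (τ z) ↔ ¬ o z) {a b : F} (hab : o a ↔ o b)
    (ha : s' a = b) (ha' : s' (s a) = s b)
    (hoff : ∀ z, z ≠ a → z ≠ b → z ≠ s a → z ≠ s b → s' z = s z) :
    JoinedOn Set.univ s' τ := by
  intro f hf hfτ
  have hfa : f b ↔ f a := by rw [← ha]; exact hf a trivial
  have hfa' : f (s b) ↔ f (s a) := by rw [← ha']; exact hf _ trivial
  -- `S` is stable under `s * τ`: the only flags of this orientation where `s'` differs from `s` are
  -- `a` and `b`, and there `f` has the right value anyway. By finiteness `a` has a preimage in `S`,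
  -- which gives `f (s a) ↔ f a`.
  let S : Set F := {x | (o x ↔ o a) ∧ (f x ↔ f a)}
  have hS : Set.MapsTo (s * τ) S S := by
    rintro x ⟨h1, h2⟩
    have ho : o ((s * τ) x) ↔ o a := by
      rw [Perm.mul_apply, hos, hoτ, not_not, h1]
    refine ⟨ho, ?_⟩
    by_cases e1 : (s * τ) x = a
    · rw [e1]
    by_cases e2 : (s * τ) x = b
    · rw [e2, hfa]
    by_cases e3 : (s * τ) x = s a
    · rw [e3, hos] at ho; tauto
    by_cases e4 : (s * τ) x = s b
    · rw [e4, hos] at ho; tauto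
    have e5 : s' ((s * τ) x) = τ x := by
      rw [hoff _ e1 e2 e3 e4, Perm.mul_apply, (hs _).2]
    rw [← hf _ trivial, e5, hfτ _ trivial, h2]
  have hbij : Set.SurjOn (s * τ) S S :=
    ((Set.toFinite S).injOn_iff_bijOn_of_mapsTo hS).1 (s * τ).injective.injOn |>.surjOn
  obtain ⟨y, ⟨-, hy⟩, hya⟩ := hbij (show a ∈ S from ⟨Iff.rfl, Iff.rfl⟩)
  have h2 : f (s a) ↔ f a := by
    rw [← hya, Perm.mul_apply, (hs _).2, hfτ _ trivial, hy, ← Perm.mul_apply, hya]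
  refine h f (fun x _ => ?_) hfτ
  by_cases e1 : x = a
  · rw [e1, h2]
  by_cases e2 : x = b
  · rw [e2]; tauto
  by_cases e3 : x = s a
  · rw [e3, (hs a).2, h2]
  by_cases e4 : x = s b
  · rw [e4, (hs b).2]; tauto
  rw [← hoff x e1 e2 e3 e4]
  exact hf x trivial

end Joined

/-! ### Smoothing crossings and Euler's inequality -/

section Turns

variable {F : Type*}

/-- All cycles of `σ` have length two or four, and `s` maps each flag to the opposite flag of its
cycle. -/
structure Turns (σ s : Perm F) : Prop where
  ne : ∀ x, σ x ≠ x
  four : ∀ x, σ (σ (σ (σ x))) = x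
  two : ∀ x, σ (σ x) = x → s x = σ x
  opp : ∀ x, σ (σ x) ≠ x → s x = σ (σ x)

theorem Turns.isPairing {σ s : Perm F} (h : Turns σ s) : IsPairing s := by
  intro x
  by_cases hx : σ (σ x) = x
  · rw [h.two x hx]
    exact ⟨h.ne x, by rw [h.two (σ x) (by rw [hx]), hx]⟩
  · rw [h.opp x hx]
    refine ⟨hx, ?_⟩
    have : σ (σ (σ (σ x))) ≠ σ (σ x) := by rw [h.four]; exact Ne.symm hx
    rw [h.opp _ this, h.four]

theorem Turns.distinct {σ s : Perm F} (h : Turns σ s) {a : F} (ha : σ (σ a) ≠ a) :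
    a ≠ σ a ∧ a ≠ σ (σ a) ∧ a ≠ σ (σ (σ a)) ∧ σ a ≠ σ (σ a) ∧ σ a ≠ σ (σ (σ a)) ∧
      σ (σ a) ≠ σ (σ (σ a)) := by
  refine ⟨(h.ne a).symm, ha.symm, fun e => h.ne _ ((h.four a).trans e), (h.ne _).symm, fun e => ha
    (σ.injective e.symm), (h.ne _).symm⟩

variable [DecidableEq F]

/-- The permutation obtained by splitting the cycle of `a` between `a` and `σ² a`. -/
def smooth (σ : Perm F) (a : F) : Perm F := swap a (σ (σ a)) * σ

/-- The opposite-flag permutation that belongs to `smooth σ a`. -/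
def smoothOpp (σ s : Perm F) (a : F) : Perm F :=
  swap (σ a) (σ (σ a)) * s * (swap (σ a) (σ (σ a)))⁻¹

theorem smooth_apply {σ s : Perm F} (h : Turns σ s) {a : F} (ha : σ (σ a) ≠ a) :
    smooth σ a a = σ a ∧ smooth σ a (σ a) = a ∧ smooth σ a (σ (σ a)) = σ (σ (σ a)) ∧
      smooth σ a (σ (σ (σ a))) = σ (σ a) ∧
      ∀ x, x ≠ a → x ≠ σ a → x ≠ σ (σ a) → x ≠ σ (σ (σ a)) → smooth σ a x = σ x := by
  obtain ⟨h1, h2, h3, h4, h5, h6⟩ := h.distinct ha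
  have h7 := h.four a
  unfold smooth
  simp only [Perm.mul_apply, swap_apply_def]
  refine ⟨?_, ?_, ?_, ?_, fun x e0 e1 e2 e3 => ?_⟩
  · simp [h1.symm, h4]
  · simp [ha]
  · simp [h3.symm, h6.symm]
  · simp [h7]
  · have : σ x ≠ a := fun e => e3 (σ.injective (by rw [e, h7]))
    have h' : σ x ≠ σ (σ a) := fun e => e1 (σ.injective e)
    simp [this, h']

theorem smoothOpp_apply {σ s : Perm F} (h : Turns σ s) {a : F} (ha : σ (σ a) ≠ a) :
    smoothOpp σ s a a = σ a ∧ smoothOpp σ s a (σ a) = a ∧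
      smoothOpp σ s a (σ (σ a)) = σ (σ (σ a)) ∧
      smoothOpp σ s a (σ (σ (σ a))) = σ (σ a) ∧
      ∀ x, x ≠ a → x ≠ σ a → x ≠ σ (σ a) → x ≠ σ (σ (σ a)) → smoothOpp σ s a x = s x := by
  obtain ⟨h1, h2, h3, h4, h5, h6⟩ := h.distinct ha
  have h7 := h.four a
  have s0 : s a = σ (σ a) := h.opp a ha
  have s1 : s (σ a) = σ (σ (σ a)) := h.opp _ h5.symm
  have s2 : s (σ (σ a)) = a := by rw [← s0, (h.isPairing a).2]
  have s3 : s (σ (σ (σ a))) = σ a := by rw [← s1, (h.isPairing _).2]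
  unfold smoothOpp
  simp only [Perm.mul_apply, swap_inv, swap_apply_def]
  refine ⟨?_, ?_, ?_, ?_, fun x e0 e1 e2 e3 => ?_⟩
  · simp [h1, h2, s0, h4.symm]
  · simp [s2, h1, h2]
  · simp [h4.symm, s1, h6.symm, h5.symm]
  · simp [h5.symm, h6.symm, s3]
  · have e4 : s x ≠ σ a := fun e => e3 (s.injective (by rw [e, s3]))
    have e5 : s x ≠ σ (σ a) := fun e => e0 (s.injective (by rw [e, s0]))
    simp [e1, e2, e4, e5]

theorem Turns.smooth {σ s : Perm F} (h : Turns σ s) {a : F} (ha : σ (σ a) ≠ a) :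
    Turns (smooth σ a) (smoothOpp σ s a) := by
  obtain ⟨h1, h2, h3, h4, h5, h6⟩ := h.distinct ha
  obtain ⟨p0, p1, p2, p3, p4⟩ := smooth_apply h ha
  obtain ⟨q0, q1, q2, q3, q4⟩ := smoothOpp_apply h ha
  have h7 := h.four a
  have key : ∀ x, (x = a ∨ x = σ a ∨ x = σ (σ a) ∨ x = σ (σ (σ a))) ∨
      ((x ≠ a ∧ x ≠ σ a ∧ x ≠ σ (σ a) ∧ x ≠ σ (σ (σ a))) ∧
       (σ x ≠ a ∧ σ x ≠ σ a ∧ σ x ≠ σ (σ a) ∧ σ x ≠ σ (σ (σ a)))) := by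
    intro x
    have : σ x = a ↔ x = σ (σ (σ a)) := by
      rw [← σ.injective.eq_iff (b := σ (σ (σ a))), h7]
    simp only [ne_eq, this, σ.injective.eq_iff]
    tauto
  have key2 : ∀ x, (x ≠ a ∧ x ≠ σ a ∧ x ≠ σ (σ a) ∧ x ≠ σ (σ (σ a))) →
      (σ x ≠ a ∧ σ x ≠ σ a ∧ σ x ≠ σ (σ a) ∧ σ x ≠ σ (σ (σ a))) := by
    intro x hx
    rcases key x with h | h
    · tauto
    · exact h.2
  have p5 : ∀ x, (x ≠ a ∧ x ≠ σ a ∧ x ≠ σ (σ a) ∧ x ≠ σ (σ (σ a))) →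
      PlaneCurve.smooth σ a x = σ x := fun x hx => p4 x hx.1 hx.2.1 hx.2.2.1 hx.2.2.2
  refine ⟨fun x => ?_, fun x => ?_, fun x => ?_, fun x => ?_⟩
  · rcases key x with (rfl | rfl | rfl | rfl) | ⟨hx, -⟩
    · rw [p0]; exact h1.symm
    · rw [p1]; exact h1
    · rw [p2]; exact h6.symm
    · rw [p3]; exact h6
    · rw [p5 x hx]; exact h.ne x
  · rcases key x with (rfl | rfl | rfl | rfl) | ⟨hx, -⟩
    · rw [p0, p1, p0, p1]
    · rw [p1, p0, p1, p0]
    · rw [p2, p3, p2, p3]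
    · rw [p3, p2, p3, p2]
    · have e1 := key2 _ hx
      have e2 := key2 _ e1
      rw [p5 x hx, p5 _ e1, p5 _ e2, p5 _ (key2 _ e2), h.four]
  · rcases key x with (rfl | rfl | rfl | rfl) | ⟨hx, -⟩
    · intro; rw [p0, q0]
    · intro; rw [p1, q1]
    · intro; rw [p2, q2]
    · intro; rw [p3, q3]
    · rw [p5 x hx, p5 _ (key2 _ hx), q4 x hx.1 hx.2.1 hx.2.2.1 hx.2.2.2]
      exact h.two x
  · rcases key x with (rfl | rfl | rfl | rfl) | ⟨hx, -⟩
    · intro h; rw [p0, p1] at h; exact absurd rfl h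
    · intro h; rw [p1, p0] at h; exact absurd rfl h
    · intro h; rw [p2, p3] at h; exact absurd rfl h
    · intro h; rw [p3, p2] at h; exact absurd rfl h
    · rw [p5 x hx, p5 _ (key2 _ hx), q4 x hx.1 hx.2.1 hx.2.2.1 hx.2.2.2]
      exact h.opp x

/-- The flags counted are those at crossings not yet smoothed, four per crossing; this is the
measure for the induction in `Turns.numCycles_le`. -/
theorem Turns.ncard_smooth [Finite F] {σ s : Perm F} (h : Turns σ s) {a : F} (ha : σ (σ a) ≠ a) :
    {x | PlaneCurve.smooth σ a (PlaneCurve.smooth σ a x) ≠ x}.ncard + 4 =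
      {x | σ (σ x) ≠ x}.ncard := by
  obtain ⟨h1, h2, h3, h4, h5, h6⟩ := h.distinct ha
  obtain ⟨p0, p1, p2, p3, p4⟩ := smooth_apply h ha
  have h7 := h.four a
  have h8 := h.four (σ a)
  have hV : ({a, σ a, σ (σ a), σ (σ (σ a))} : Set F).ncard = 4 := by
    rw [Set.ncard_insert_of_notMem (by simp [h1, h2, h3]),
      Set.ncard_insert_of_notMem (by simp [h4, h5]), Set.ncard_pair h6]
  rw [← hV, ← Set.ncard_union_eq]
  · congr 1
    ext x
    simp only [Set.mem_union, Set.mem_ofPred_eq, Set.mem_insert_iff, Set.mem_singleton_iff]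
    by_cases e0 : x = a
    · subst e0; simp [ha]
    by_cases e1 : x = σ a
    · subst e1; simp [h5.symm]
    by_cases e2 : x = σ (σ a)
    · subst e2; simp [h7, h2]
    by_cases e3 : x = σ (σ (σ a))
    · subst e3; simp [h7, h5]
    have e4 : σ x ≠ a := fun e => e3 (σ.injective (by rw [e, h7]))
    rw [p4 x e0 e1 e2 e3, p4 (σ x) e4 (fun e => e0 (σ.injective e)) (fun e => e1 (σ.injective e))
      (fun e => e2 (σ.injective e))]
    simp [e0, e1, e2, e3]
  · rw [Set.disjoint_left]
    intro x hx hx'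
    simp only [Set.mem_ofPred_eq, Set.mem_insert_iff, Set.mem_singleton_iff] at hx hx'
    rcases hx' with rfl | rfl | rfl | rfl
    · rw [p0, p1] at hx; exact hx rfl
    · rw [p1, p0] at hx; exact hx rfl
    · rw [p2, p3] at hx; exact hx rfl
    · rw [p3, p2] at hx; exact hx rfl

theorem Turns.joinedOn_smooth [Finite F] {σ s τ : Perm F} (h : Turns σ s)
    (hj : JoinedOn Set.univ s τ) {o : F → Prop} (hos : ∀ z, o (s z) ↔ ¬ o z)
    (hoτ : ∀ z, o (τ z) ↔ ¬ o z) {a : F} (ha : σ (σ a) ≠ a) (hoa : o a ↔ o (σ a)) :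
    JoinedOn Set.univ (smoothOpp σ s a) τ := by
  obtain ⟨h1, h2, h3, h4, h5, h6⟩ := h.distinct ha
  obtain ⟨q0, q1, q2, q3, q4⟩ := smoothOpp_apply h ha
  have s0 : s a = σ (σ a) := h.opp a ha
  have s1 : s (σ a) = σ (σ (σ a)) := h.opp _ h5.symm
  refine joinedOn_smoothing h.isPairing hj hos hoτ hoa q0 (by rw [s0, s1, q2]) ?_
  rw [s0, s1]
  exact q4

/-- Some corner of each vertex can be smoothed so that the curve stays a single curve. -/
theorem Turns.joinedOn_smooth_or [Finite F] {σ s τ : Perm F} (h : Turns σ s) (hτ : IsPairing τ)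
    (hj : JoinedOn Set.univ s τ) {a : F} (ha : σ (σ a) ≠ a) :
    JoinedOn Set.univ (smoothOpp σ s a) τ ∨ JoinedOn Set.univ (smoothOpp σ s (σ a)) τ := by
  obtain ⟨o, hos, hoτ, -⟩ := hj.exists_orientation h.isPairing hτ a
  by_cases hoa : o a ↔ o (σ a)
  · exact Or.inl (h.joinedOn_smooth hj hos hoτ ha hoa)
  -- Opposite flags have opposite orientations, so if `a` and `σ a` disagree then `σ a` and `σ (σ
  -- a)` agree.
  · refine Or.inr (h.joinedOn_smooth hj hos hoτ (fun e => ha (σ.injective e)) ?_)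
    rw [← h.opp a ha, hos]
    tauto

/-- Euler's inequality for a single curve with `m` crossings. -/
theorem Turns.numCycles_le [Finite F] [Nonempty F] {τ : Perm F} (hτ : IsPairing τ) (m : ℕ) :
    ∀ {σ s : Perm F}, Turns σ s → JoinedOn Set.univ s τ → {x | σ (σ x) ≠ x}.ncard = 4 * m →
      numCycles (σ * τ) ≤ m + 2 := by
  induction m with
  | zero =>
    intro σ s h hj hm
    rw [mul_zero, Set.ncard_eq_zero, Set.eq_empty_iff_forall_notMem] at hm
    -- Without crossings every vertex has degree two, and the curve is a circle with two sides.
    have : σ = s := by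
      ext x; exact (h.two x (not_not.1 (hm x))).symm
    rw [this, (joinedOn_univ_iff_numCycles h.isPairing hτ).1 hj]
  | succ m ih =>
    have key : ∀ {σ s : Perm F}, Turns σ s → {x | σ (σ x) ≠ x}.ncard = 4 * (m + 1) →
        ∀ a, σ (σ a) ≠ a → JoinedOn Set.univ (smoothOpp σ s a) τ →
        numCycles (σ * τ) ≤ m + 1 + 2 := by
      intro σ s h hm a ha hja
      have h1 := ih (h.smooth ha) hja (by have := h.ncard_smooth ha; omega)
      have h2 := numCycles_le_swap_mul (σ * τ) a (σ (σ a))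
      rw [← mul_assoc] at h2
      exact h2.trans (Nat.succ_le_succ h1)
    intro σ s h hj hm
    obtain ⟨a, ha⟩ : {x | σ (σ x) ≠ x}.Nonempty := by
      rw [← Set.ncard_pos]; omega
    rcases h.joinedOn_smooth_or hτ hj ha with h1 | h1
    · exact key h hm a ha h1
    · exact key h hm (σ a) (fun e => ha (σ.injective e)) h1

end Turns

/-! ### Reconnecting two edges -/

section Reconnect

variable {F : Type*} [DecidableEq F]

/-- Replaces the edges of `p` and `q` by an edge that joins `p` and `q` and an edge that joins
their former partners. -/
def reconnect (τ : Perm F) (p q : F) : Perm F :=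
  swap q (τ p) * τ * (swap q (τ p))⁻¹

theorem IsPairing.reconnect {τ : Perm F} (h : IsPairing τ) (p q : F) :
    IsPairing (reconnect τ p q) := h.conj _

theorem reconnect_apply {τ : Perm F} (h : IsPairing τ) {p q : F} (hpq : p ≠ q) (z : F) :
    reconnect τ p q z = if z = p then q else if z = q then p else if z = τ p then τ q else
      if z = τ q then τ p else τ z := by
  have hp := h p
  have hq := h q
  have hz := h z
  unfold reconnect
  simp only [Perm.mul_apply, swap_inv, swap_apply_def]
  grind

/-- Conjugating `τ` by a transposition multiplies `σ * τ` by two transpositions. -/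
theorem numCycles_le_reconnect [Finite F] (σ τ : Perm F) (p q : F) :
    numCycles (σ * τ) ≤ numCycles (σ * reconnect τ p q) + 2 := by
  have h1 := numCycles_le_swap_mul (σ * τ) (σ (τ q)) (σ (τ (τ p)))
  have h2 := numCycles_le_swap_mul (swap (σ (τ q)) (σ (τ (τ p))) * (σ * τ)) (σ q) (σ (τ p))
  have e : σ * reconnect τ p q =
      swap (σ q) (σ (τ p)) * (swap (σ (τ q)) (σ (τ (τ p))) * (σ * τ)) := by
    ext z
    unfold reconnect
    simp only [Perm.mul_apply, swap_inv]
    rw [← Equiv.Perm.mul_apply σ (swap _ _), Equiv.mul_swap_eq_swap_mul]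
    simp only [Perm.mul_apply]
    congr 1
    rw [← Equiv.Perm.mul_apply τ (swap _ _), Equiv.mul_swap_eq_swap_mul, Perm.mul_apply,
      ← Equiv.Perm.mul_apply σ (swap _ _), Equiv.mul_swap_eq_swap_mul, Perm.mul_apply]
  rw [e]
  omega

/-- A vertex of degree two becomes a free circle, whose two sides `p` and `q` are new faces; each of
the two transpositions splits off one of them. -/
theorem numCycles_add_two_le_reconnect [Finite F] {σ τ : Perm F} (h : IsPairing τ) {p q : F}
    (hp : σ p = q) (hq : σ q = p) (hpq : p ≠ q) (hne : τ p ≠ q) :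
    numCycles (σ * τ) + 2 ≤ numCycles (σ * reconnect τ p q) := by
  have hτp := (h p).2
  have e : σ * reconnect τ p q =
      swap p (σ (τ p)) * (swap q (σ (τ q)) * (σ * τ)) := by
    ext z
    unfold reconnect
    simp only [Perm.mul_apply, swap_inv]
    rw [← Equiv.Perm.mul_apply σ (swap _ _), Equiv.mul_swap_eq_swap_mul]
    simp only [Perm.mul_apply]
    rw [hq]
    congr 1
    rw [← Equiv.Perm.mul_apply τ (swap _ _), Equiv.mul_swap_eq_swap_mul, Perm.mul_apply,
      ← Equiv.Perm.mul_apply σ (swap _ _), Equiv.mul_swap_eq_swap_mul, Perm.mul_apply, hτp, hp,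
      swap_comm]
  have h1 : (σ * τ) q ≠ q := by
    intro hh
    rw [Perm.mul_apply] at hh
    have : τ q = p := σ.injective (hh.trans hp.symm)
    exact hne (by rw [← this, (h q).2])
  have h2 := numCycles_succ_le_swap_mul h1
  rw [Perm.mul_apply] at h2
  have e3 : (swap q (σ (τ q)) * (σ * τ)) p = σ (τ p) := by
    rw [Perm.mul_apply, Perm.mul_apply, swap_apply_of_ne_of_ne]
    · intro hh
      exact (h p).1 (σ.injective (hh.trans hp.symm))
    · intro hh
      exact hpq (τ.injective (σ.injective hh))
  have h3 : (swap q (σ (τ q)) * (σ * τ)) p ≠ p := by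
    rw [e3]
    intro hh
    exact hne (σ.injective (hh.trans hq.symm))
  have h4 := numCycles_succ_le_swap_mul h3
  rw [e3] at h4
  rw [e]
  omega

end Reconnect

/-! ### Detaching a crossing and reattaching it as a kink -/

section Surgery

variable {F : Type*}

/-- All cycles of `σ` have length four. -/
def IsQuartic (σ : Perm F) : Prop := ∀ x, σ (σ x) ≠ x ∧ σ (σ (σ (σ x))) = x

theorem IsQuartic.turns {σ : Perm F} (h : IsQuartic σ) : Turns σ (σ * σ) where
  ne x hx := (h x).1 (by rw [hx, hx])
  four x := (h x).2
  two x hx := absurd hx (h x).1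
  opp _ _ := rfl

/-- The flags of the vertex of `a`. -/
def vert (σ : Perm F) (a : F) : Set F := {a, σ a, σ (σ a), σ (σ (σ a))}

theorem mem_vert {σ : Perm F} {a x : F} :
    x ∈ vert σ a ↔ x = a ∨ x = σ a ∨ x = σ (σ a) ∨ x = σ (σ (σ a)) := Iff.rfl

theorem IsQuartic.apply_mem_vert {σ : Perm F} (h : IsQuartic σ) {a x : F} :
    σ x ∈ vert σ a ↔ x ∈ vert σ a := by
  have : σ x = a ↔ x = σ (σ (σ a)) := by
    rw [← σ.injective.eq_iff (b := σ (σ (σ a))), (h a).2]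
  simp only [mem_vert, this, σ.injective.eq_iff]
  tauto

/-- The vertex of `a` is detached from the rest of the curve. -/
def Floats (σ τ : Perm F) (a : F) : Prop := τ a = σ a ∧ τ (σ (σ a)) = σ (σ (σ a))

theorem Floats.apply {σ τ : Perm F} (hτ : IsPairing τ) {a : F} (h : Floats σ τ a) :
    τ a = σ a ∧ τ (σ a) = a ∧ τ (σ (σ a)) = σ (σ (σ a)) ∧ τ (σ (σ (σ a))) = σ (σ a) :=
  ⟨h.1, by rw [← h.1, (hτ a).2], h.2, by rw [← h.2, (hτ _).2]⟩

theorem Floats.mem_vert_iff {σ τ : Perm F} (hτ : IsPairing τ) {a : F} (h : Floats σ τ a) {x : F} :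
    τ x ∈ vert σ a ↔ x ∈ vert σ a := by
  obtain ⟨h0, h1, h2, h3⟩ := h.apply hτ
  have key : ∀ y, y ∈ vert σ a → τ y ∈ vert σ a := by
    rintro y (rfl | rfl | rfl | rfl)
    · rw [h0]; simp [mem_vert]
    · rw [h1]; simp [mem_vert]
    · rw [h2]; simp [mem_vert]
    · rw [h3]; simp [mem_vert]
  exact ⟨fun h => by simpa [(hτ x).2] using key _ h, key x⟩

variable [DecidableEq F]

/-- Smooths the vertex of `a` and detaches its flags. -/
def extract (σ τ : Perm F) (a : F) : Perm F :=
  reconnect (reconnect τ a (σ a)) (σ (σ a)) (σ (σ (σ a)))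

theorem IsPairing.extract {τ : Perm F} (h : IsPairing τ) (σ : Perm F) (a : F) :
    IsPairing (extract σ τ a) := (h.reconnect _ _).reconnect _ _

/-- After smoothing, the two halves of the crossing are vertices of degree two. Freeing each gains
two faces, and gluing the halves together again loses at most one. -/
theorem numCycles_add_two_le_extract [Finite F] {σ τ : Perm F} (hσ : IsQuartic σ)
    (h : IsPairing τ) {a : F} (h1 : τ a ≠ σ a)
    (h2 : reconnect τ a (σ a) (σ (σ a)) ≠ σ (σ (σ a))) :
    numCycles (smooth σ a * τ) + 3 ≤ numCycles (σ * extract σ τ a) := by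
  obtain ⟨p0, p1, p2, p3, -⟩ := smooth_apply hσ.turns (hσ a).1
  obtain ⟨d1, d2, d3, d4, d5, d6⟩ := hσ.turns.distinct (hσ a).1
  have e2 := numCycles_add_two_le_reconnect h p0 p1 d1 h1
  have e3 := numCycles_add_two_le_reconnect (h.reconnect _ _) p2 p3 d6 h2
  have e4 := numCycles_le_swap_mul (smooth σ a * extract σ τ a) a (σ (σ a))
  have e5 : swap a (σ (σ a)) * (smooth σ a * extract σ τ a) = σ * extract σ τ a := by
    rw [smooth, mul_assoc, ← mul_assoc, swap_mul_self, one_mul]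
  rw [e5] at e4
  change _ ≤ numCycles (smooth σ a * extract σ τ a) at e3
  omega

theorem numCycles_le_smooth [Finite F] (σ τ : Perm F) (a : F) :
    numCycles (σ * τ) ≤ numCycles (smooth σ a * τ) + 1 := by
  rw [smooth, mul_assoc]
  exact numCycles_le_swap_mul _ _ _

theorem extract_apply {σ τ : Perm F} (hσ : IsQuartic σ) (h : IsPairing τ) {a : F}
    (hl : ∀ x ∈ vert σ a, τ x ∉ vert σ a) (z : F) :
    extract σ τ a z = if z = a then σ a else if z = σ a then a else
      if z = σ (σ a) then σ (σ (σ a)) else if z = σ (σ (σ a)) then σ (σ a) else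
      if z = τ a then τ (σ a) else if z = τ (σ a) then τ a else
      if z = τ (σ (σ a)) then τ (σ (σ (σ a))) else if z = τ (σ (σ (σ a))) then τ (σ (σ a)) else
      τ z := by
  obtain ⟨d1, d2, d3, d4, d5, d6⟩ := hσ.turns.distinct (hσ a).1
  simp only [mem_vert] at hl
  have l0 := hl a (by simp)
  have l1 := hl (σ a) (by simp)
  have l2 := hl (σ (σ a)) (by simp)
  have l3 := hl (σ (σ (σ a))) (by simp)
  have hinj := τ.injective
  have i1 := hinj.ne d1
  have i2 := hinj.ne d2
  have i3 := hinj.ne d3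
  have i4 := hinj.ne d4
  have i5 := hinj.ne d5
  have i6 := hinj.ne d6
  unfold extract
  rw [reconnect_apply (h.reconnect _ _) d6, reconnect_apply h d1, reconnect_apply h d1,
    reconnect_apply h d1]
  clear hl
  grind

theorem extract_nondegenerate {σ τ : Perm F} (hσ : IsQuartic σ) (h : IsPairing τ) {a : F}
    (hl : ∀ x ∈ vert σ a, τ x ∉ vert σ a) :
    τ a ≠ σ a ∧ reconnect τ a (σ a) (σ (σ a)) ≠ σ (σ (σ a)) := by
  obtain ⟨d1, d2, d3, d4, d5, d6⟩ := hσ.turns.distinct (hσ a).1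
  simp only [mem_vert] at hl
  have l0 := hl a (by simp)
  have l1 := hl (σ a) (by simp)
  have l2 := hl (σ (σ a)) (by simp)
  refine ⟨by tauto, ?_⟩
  rw [reconnect_apply h d1]
  clear hl
  grind

/-- Attaches the detached vertex of `a` as a kink on the edge of `b`. -/
def kink (σ τ : Perm F) (a b : F) : Perm F :=
  reconnect (reconnect τ a (τ b)) (σ (σ a)) (σ a)

theorem IsPairing.kink {τ : Perm F} (h : IsPairing τ) (σ : Perm F) (a b : F) :
    IsPairing (kink σ τ a b) := (h.reconnect _ _).reconnect _ _

theorem kink_apply {σ τ : Perm F} (hσ : IsQuartic σ) (h : IsPairing τ) {a b : F}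
    (hf : Floats σ τ a) (hb : b ∉ vert σ a) (z : F) :
    kink σ τ a b z = if z = a then τ b else if z = τ b then a else
      if z = σ (σ a) then σ a else if z = σ a then σ (σ a) else
      if z = σ (σ (σ a)) then b else if z = b then σ (σ (σ a)) else τ z := by
  obtain ⟨d1, d2, d3, d4, d5, d6⟩ := hσ.turns.distinct (hσ a).1
  obtain ⟨f0, f1, f2, f3⟩ := hf.apply h
  have hb' : τ b ∉ vert σ a := fun e => hb ((hf.mem_vert_iff h).1 e)
  have hbb := (h b).2
  have hbn := (h b).1
  simp only [mem_vert] at hb hb'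
  have hne : a ≠ τ b := by tauto
  unfold kink
  rw [reconnect_apply (h.reconnect _ _) d4.symm, reconnect_apply h hne, reconnect_apply h hne,
    reconnect_apply h hne]
  grind

/-- Splitting the crossing gains a face, each of the two reconnections loses at most two, and gluing
the halves gains one because `a` then follows `σ (σ a)` in a face. -/
theorem numCycles_le_kink [Finite F] {σ τ : Perm F} (hσ : IsQuartic σ) (h : IsPairing τ) {a b : F}
    (hf : Floats σ τ a) (hb : b ∉ vert σ a) :
    numCycles (σ * τ) ≤ numCycles (σ * kink σ τ a b) + 2 := by
  obtain ⟨p0, p1, p2, p3, -⟩ := smooth_apply hσ.turns (hσ a).1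
  obtain ⟨d1, d2, d3, d4, d5, d6⟩ := hσ.turns.distinct (hσ a).1
  obtain ⟨f0, f1, f2, f3⟩ := hf.apply h
  have e0 : (σ * τ) a = σ (σ a) := by rw [Perm.mul_apply, f0]
  have e1 := numCycles_succ_le_swap_mul (φ := σ * τ) (p := a) (by rw [e0]; exact d2.symm)
  rw [e0, ← mul_assoc] at e1
  change _ ≤ numCycles (smooth σ a * τ) at e1
  have e2 := numCycles_le_reconnect (smooth σ a) τ a (τ b)
  have e3 := numCycles_le_reconnect (smooth σ a) (reconnect τ a (τ b)) (σ (σ a)) (σ a)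
  change _ ≤ numCycles (smooth σ a * kink σ τ a b) + 2 at e3
  have hk : kink σ τ a b (σ (σ a)) = σ a := by
    have hb' : τ b ∉ vert σ a := fun e => hb ((hf.mem_vert_iff h).1 e)
    simp only [mem_vert] at hb'
    rw [kink_apply hσ h hf hb, if_neg d2.symm, if_neg (by tauto), if_pos rfl]
  have e4 : (smooth σ a * kink σ τ a b) (σ (σ a)) = a := by rw [Perm.mul_apply, hk, p1]
  have e5 := numCycles_succ_le_swap_mul (φ := smooth σ a * kink σ τ a b) (p := σ (σ a))
    (by rw [e4]; exact d2)
  rw [e4, swap_comm, ← mul_assoc, smooth, ← mul_assoc, swap_mul_self, one_mul] at e5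
  rw [smooth] at e1 e2 e3
  omega

theorem kink_values {σ τ : Perm F} (hσ : IsQuartic σ) (h : IsPairing τ) {a b : F}
    (hf : Floats σ τ a) (hb : b ∉ vert σ a) :
    kink σ τ a b a = τ b ∧ kink σ τ a b (τ b) = a ∧ kink σ τ a b (σ (σ a)) = σ a ∧
      kink σ τ a b (σ a) = σ (σ a) ∧ kink σ τ a b (σ (σ (σ a))) = b ∧
      kink σ τ a b b = σ (σ (σ a)) ∧
      ∀ z, z ∉ vert σ a → z ≠ b → z ≠ τ b → kink σ τ a b z = τ z := by
  obtain ⟨d1, d2, d3, d4, d5, d6⟩ := hσ.turns.distinct (hσ a).1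
  have hb' : τ b ∉ vert σ a := fun e => hb ((hf.mem_vert_iff h).1 e)
  have hk := kink_apply hσ h hf hb
  have hbn := (h b).1
  simp only [mem_vert, not_or] at hb hb'
  refine ⟨?_, ?_, ?_, ?_, ?_, ?_, fun z hz h1 h2 => ?_⟩
  · rw [hk, if_pos rfl]
  · rw [hk, if_neg hb'.1, if_pos rfl]
  · rw [hk, if_neg d2.symm, if_neg (Ne.symm hb'.2.2.1), if_pos rfl]
  · rw [hk, if_neg d1.symm, if_neg (Ne.symm hb'.2.1), if_neg d4, if_pos rfl]
  · rw [hk, if_neg d3.symm, if_neg (Ne.symm hb'.2.2.2), if_neg d6.symm, if_neg d5.symm, if_pos rfl]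
  · rw [hk, if_neg hb.1, if_neg hbn.symm, if_neg hb.2.2.1, if_neg hb.2.1, if_neg hb.2.2.2,
      if_pos rfl]
  · simp only [mem_vert, not_or] at hz
    rw [hk, if_neg hz.1, if_neg h2, if_neg hz.2.2.1, if_neg hz.2.1, if_neg hz.2.2.2, if_neg h1]

/-- The kink inserts the path `a, σ² a, σ a, σ³ a` between `τ b` and `b`, so the curve runs through
the whole crossing. -/
theorem joinedOn_kink {σ τ : Perm F} (hσ : IsQuartic σ) (h : IsPairing τ) {a b : F}
    (hf : Floats σ τ a) {A : Set F} (hA : Disjoint A (vert σ a)) (hb : b ∈ A)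
    (hj : JoinedOn A (σ * σ) τ) (hτA : ∀ x ∈ A, τ x ∈ A) :
    JoinedOn (A ∪ vert σ a) (σ * σ) (kink σ τ a b) := by
  rw [Set.disjoint_left] at hA
  have hbv := hA hb
  obtain ⟨k1, -, k2, -, k3, -, hk⟩ := kink_values hσ h hf hbv
  intro f hfs hfτ
  have g1 := hfτ a (by simp [mem_vert])
  have g2 := hfτ (σ (σ a)) (by simp [mem_vert])
  have g3 := hfτ (σ (σ (σ a))) (by simp [mem_vert])
  have s1 : f (σ (σ a)) ↔ f a := hfs a (by simp [mem_vert])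
  have s2 : f (σ (σ (σ a))) ↔ f (σ a) := hfs (σ a) (by simp [mem_vert])
  rw [k1] at g1
  rw [k2] at g2
  rw [k3] at g3
  have hAc : ∀ x ∈ A, ∀ y ∈ A, f x → f y := by
    refine hj f (fun x hx => hfs x (Or.inl hx)) (fun x hx => ?_)
    by_cases e1 : x = b
    · subst e1; tauto
    by_cases e2 : x = τ b
    · subst e2; rw [(h b).2]; tauto
    rw [← hk x (hA hx) e1 e2]
    exact hfτ x (Or.inl hx)
  have hall : ∀ x ∈ A ∪ vert σ a, (f x ↔ f b) := by
    have h1 := hAc _ (hτA b hb) b hb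
    have h2 := hAc b hb _ (hτA b hb)
    rintro x (hx | rfl | rfl | rfl | rfl)
    · exact ⟨hAc x hx b hb, hAc b hb x hx⟩
    all_goals tauto
  intro x hx y hy hfx
  rw [hall y hy, ← hall x hx]
  exact hfx

end Surgery

/-! ### Reversible removal at loops and at corners of small degree -/

section Detach

variable {F : Type*} [DecidableEq F]

theorem extract_values {σ τ : Perm F} (hσ : IsQuartic σ) (h : IsPairing τ) {a : F}
    (hl : ∀ x ∈ vert σ a, τ x ∉ vert σ a) :
    (extract σ τ a a = σ a ∧ extract σ τ a (σ a) = a ∧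
      extract σ τ a (σ (σ a)) = σ (σ (σ a)) ∧ extract σ τ a (σ (σ (σ a))) = σ (σ a)) ∧
    (extract σ τ a (τ a) = τ (σ a) ∧ extract σ τ a (τ (σ a)) = τ a ∧
      extract σ τ a (τ (σ (σ a))) = τ (σ (σ (σ a))) ∧
      extract σ τ a (τ (σ (σ (σ a)))) = τ (σ (σ a))) ∧
    ∀ z, z ∉ vert σ a → τ z ∉ vert σ a → extract σ τ a z = τ z := by
  obtain ⟨d1, d2, d3, d4, d5, d6⟩ := hσ.turns.distinct (hσ a).1
  have hx := extract_apply hσ h hl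
  have l0 := hl a (by simp [mem_vert])
  have l1 := hl (σ a) (by simp [mem_vert])
  have l2 := hl (σ (σ a)) (by simp [mem_vert])
  have l3 := hl (σ (σ (σ a))) (by simp [mem_vert])
  have hinj := τ.injective
  simp only [mem_vert, not_or] at l0 l1 l2 l3
  refine ⟨⟨?_, ?_, ?_, ?_⟩, ⟨?_, ?_, ?_, ?_⟩, fun z hz hz' => ?_⟩
  · rw [hx, if_pos rfl]
  · rw [hx, if_neg d1.symm, if_pos rfl]
  · rw [hx, if_neg d2.symm, if_neg d4.symm, if_pos rfl]
  · rw [hx, if_neg d3.symm, if_neg d5.symm, if_neg d6.symm, if_pos rfl]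
  · rw [hx, if_neg l0.1, if_neg l0.2.1, if_neg l0.2.2.1, if_neg l0.2.2.2, if_pos rfl]
  · rw [hx, if_neg l1.1, if_neg l1.2.1, if_neg l1.2.2.1, if_neg l1.2.2.2,
      if_neg (hinj.ne d1.symm), if_pos rfl]
  · rw [hx, if_neg l2.1, if_neg l2.2.1, if_neg l2.2.2.1, if_neg l2.2.2.2,
      if_neg (hinj.ne d2.symm), if_neg (hinj.ne d4.symm), if_pos rfl]
  · rw [hx, if_neg l3.1, if_neg l3.2.1, if_neg l3.2.2.1, if_neg l3.2.2.2,
      if_neg (hinj.ne d3.symm), if_neg (hinj.ne d5.symm), if_neg (hinj.ne d6.symm), if_pos rfl]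
  · have hne : ∀ y ∈ vert σ a, z ≠ τ y := by
      rintro y hy rfl
      rw [(h y).2] at hz'
      exact hz' hy
    have m0 := hne a (by simp [mem_vert])
    have m1 := hne (σ a) (by simp [mem_vert])
    have m2 := hne (σ (σ a)) (by simp [mem_vert])
    have m3 := hne (σ (σ (σ a))) (by simp [mem_vert])
    simp only [mem_vert, not_or] at hz
    rw [hx, if_neg hz.1, if_neg hz.2.1, if_neg hz.2.2.1, if_neg hz.2.2.2, if_neg m0, if_neg m1,
      if_neg m2, if_neg m3]

theorem extract_loop_values {σ τ : Perm F} (hσ : IsQuartic σ) (h : IsPairing τ) {a : F}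
    (ha : τ a = σ (σ (σ a))) (h1 : τ (σ a) ∉ vert σ a) (h2 : τ (σ (σ a)) ∉ vert σ a) :
    (extract σ τ a a = σ a ∧ extract σ τ a (σ (σ a)) = σ (σ (σ a))) ∧
    (extract σ τ a (τ (σ a)) = τ (σ (σ a)) ∧ extract σ τ a (τ (σ (σ a))) = τ (σ a)) ∧
    (∀ z, z ∉ vert σ a → τ z ∉ vert σ a → extract σ τ a z = τ z) ∧
    τ a ≠ σ a ∧ reconnect τ a (σ a) (σ (σ a)) ≠ σ (σ (σ a)) := by
  obtain ⟨d1, d2, d3, d4, d5, d6⟩ := hσ.turns.distinct (hσ a).1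
  have e0 := (h a).2
  have e1 := (h (σ a)).2
  have e2 := (h (σ (σ a))).2
  have hinj := τ.injective
  have i4 := hinj.ne d4
  simp only [mem_vert, not_or] at h1 h2 ⊢
  have hr := reconnect_apply h d1
  have hr2 : reconnect τ a (σ a) (σ (σ a)) = τ (σ (σ a)) := by rw [hr]; grind
  have hr3 : reconnect τ a (σ a) (σ (σ (σ a))) = τ (σ a) := by rw [hr]; grind
  have hx := reconnect_apply (h.reconnect a (σ a)) d6
  rw [hr2, hr3] at hx
  unfold extract
  refine ⟨⟨?_, ?_⟩, ⟨?_, ?_⟩, fun z hz hz' => ?_, ?_, ?_⟩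
  · rw [hx, hr]; grind
  · rw [hx]; grind
  · rw [hx]; grind
  · rw [hx]; grind
  · have hz2 := (h z).2
    rw [hx, hr]; grind
  · rw [ha]; exact d5.symm
  · rw [hr2]; tauto

/-- How to recover `τ` from the pairing `τ'` in which the vertex of `a` has been detached. -/
inductive Code (σ τ τ' : Perm F) (a : F) : F → ℕ → Prop
  | loop (p : F) (h0 : τ a = σ (σ (σ a))) (h1 : τ (σ a) = p) (h2 : τ (σ (σ a)) = τ' p)
      (hoff : ∀ z, z ∉ vert σ a → τ z ∉ vert σ a → τ' z = τ z) : Code σ τ τ' a p 0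
  -- `g` is the flag formerly joined to `σ a`, at the neighbouring crossing that now forms a kink.
  | bigons (g : F) (h0 : τ a = τ' g) (h1 : τ (σ a) = g) (h2 : τ (σ (σ a)) = σ (σ (σ g)))
      (h3 : τ (σ (σ (σ a))) = σ (τ' g)) (h4 : τ (σ g) = τ' (σ (σ (σ g))))
      (h5 : τ (σ (σ g)) = τ' (σ (τ' g)))
      (hoff : ∀ z, z ∉ vert σ a ∪ vert σ g → τ z ∉ vert σ a ∪ vert σ g → τ' z = τ z) :
      Code σ τ τ' a g 1
  -- Once `x = τ a` is known, the other place to reattach is found by walking `i` steps along the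
  -- merged face. The shift by two keeps the symbols 0 and 1 for the other cases.
  | corner (x : F) (i : ℕ) (h0 : τ a = x) (h1 : τ (σ a) = τ' x)
      (h2 : τ (σ (σ a)) = τ' ((σ * τ')^[i] (σ x))) (h3 : τ (σ (σ (σ a))) = (σ * τ')^[i] (σ x))
      (hoff : ∀ z, z ∉ vert σ a → τ z ∉ vert σ a → τ' z = τ z) : Code σ τ τ' a x (i + 2)

/-- An edge that meets `S` is determined by its end in `S`, and all other edges are those of `τ'`.
-/
theorem IsPairing.eq_of_eqOn {F : Type*} {τ₁ τ₂ τ' : Perm F} (h1 : IsPairing τ₁)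
    (h2 : IsPairing τ₂) {S : Set F}
    (hS : ∀ z ∈ S, τ₁ z = τ₂ z) (ho1 : ∀ z, z ∉ S → τ₁ z ∉ S → τ' z = τ₁ z)
    (ho2 : ∀ z, z ∉ S → τ₂ z ∉ S → τ' z = τ₂ z) : τ₁ = τ₂ := by
  ext z
  by_cases hz : z ∈ S
  · exact hS z hz
  by_cases hz1 : τ₁ z ∈ S
  · have := hS _ hz1
    rw [(h1 z).2] at this
    conv_rhs => rw [this]
    rw [(h2 _).2]
  by_cases hz2 : τ₂ z ∈ S
  · have := hS _ hz2
    rw [(h2 z).2] at this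
    conv_lhs => rw [← this]
    rw [(h1 _).2]
  rw [← ho1 z hz hz1, ho2 z hz hz2]

theorem Code.unique {F : Type*} {σ τ₁ τ₂ τ' : Perm F} {a m : F} {i : ℕ}
    (h1 : IsPairing τ₁) (h2 : IsPairing τ₂) (c1 : Code σ τ₁ τ' a m i) (c2 : Code σ τ₂ τ' a m i) :
    τ₁ = τ₂ := by
  cases c1 with
  | loop p0 p1 p2 po =>
    cases c2 with
    | loop q0 q1 q2 qo =>
      refine h1.eq_of_eqOn h2 ?_ po qo
      rintro z (rfl | rfl | rfl | rfl)
      · rw [p0, q0]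
      · rw [p1, q1]
      · rw [p2, q2]
      · conv_lhs => rw [← p0, (h1 _).2]
        rw [← q0, (h2 _).2]
  | bigons p0 p1 p2 p3 p4 p5 po =>
    cases c2 with
    | bigons q0 q1 q2 q3 q4 q5 qo =>
      refine h1.eq_of_eqOn h2 ?_ po qo
      rintro z ((rfl | rfl | rfl | rfl) | (rfl | rfl | rfl | rfl))
      · rw [p0, q0]
      · rw [p1, q1]
      · rw [p2, q2]
      · rw [p3, q3]
      · conv_lhs => rw [← p1, (h1 _).2]
        conv_rhs => rw [← q1, (h2 _).2]
      · rw [p4, q4]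
      · rw [p5, q5]
      · conv_lhs => rw [← p2, (h1 _).2]
        rw [← q2, (h2 _).2]
  | corner j p0 p1 p2 p3 po =>
    cases c2 with
    | corner _ q0 q1 q2 q3 qo =>
      refine h1.eq_of_eqOn h2 ?_ po qo
      rintro z (rfl | rfl | rfl | rfl)
      · rw [p0, q0]
      · rw [p1, q1]
      · rw [p2, q2]
      · rw [p3, q3]

/-- `σ` and `τ` are the vertices and edges of a plane curve with `n` crossings. -/
structure IsCurve (n : ℕ) (σ τ : Perm F) : Prop where
  quartic : IsQuartic σ
  pairing : IsPairing τ
  joined : JoinedOn Set.univ (σ * σ) τ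
  faces : n + 2 ≤ numCycles (σ * τ)

/-- `τ'` is a curve with `n - 1` crossings next to the detached vertex of `a`. -/
structure Detached (n : ℕ) (σ τ' : Perm F) (a : F) : Prop where
  pairing : IsPairing τ'
  floats : Floats σ τ' a
  joined : JoinedOn (vert σ a)ᶜ (σ * σ) τ'
  -- The detached crossing carries three faces of its own, and a curve with `n - 1` crossings has `n
  -- + 1`.
  faces : n + 4 ≤ numCycles (σ * τ')

/-- The vertex of `a` can be detached in a way that can be undone with little information. -/
def Detachable (n : ℕ) (σ τ : Perm F) (a : F) : Prop :=
  ∃ τ' m i, Detached n σ τ' a ∧ Code σ τ τ' a m i ∧ i < 13 ∧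
    -- Only the crossing of `a` and one neighbour, needed for bigons, may be disturbed, so that
    -- distant faces survive.
    ∀ z, z ∉ vert σ a ∪ vert σ (τ (σ (σ a))) → τ z ∉ vert σ a ∪ vert σ (τ (σ (σ a))) → τ' z = τ z

/-- This rules out the small configurations that would close up into a whole curve. -/
theorem IsCurve.not_closed [Fintype F] {n : ℕ} {σ τ : Perm F} (h : IsCurve n σ τ) (S : Finset F)
    (hS : S.card < Fintype.card F) {a : F} (ha : a ∈ S) (hsS : ∀ x, σ (σ x) ∈ S ↔ x ∈ S)
    (hτS : ∀ x ∈ S, τ x ∈ S) : False := by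
  obtain ⟨y, hy⟩ : ∃ y, y ∉ S := by
    by_contra! hall
    exact hS.ne ((Finset.eq_univ_iff_forall.2 hall) ▸ Finset.card_univ)
  refine hy (h.joined (· ∈ S) (fun x _ => hsS x) (fun x _ => ⟨fun hx => ?_, hτS x⟩) a trivial y
    trivial ha)
  simpa [(h.pairing x).2] using hτS _ hx

theorem IsCurve.opp_ne [Fintype F] {n : ℕ} {σ τ : Perm F} (h : IsCurve n σ τ)
    (hF : 2 < Fintype.card F) (a : F) : τ a ≠ σ (σ a) := by
  classical
  intro ha
  have h2 := h.pairing a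
  rw [ha] at h2
  have h4 := (h.quartic a).2
  refine h.not_closed {a, σ (σ a)} (Finset.card_le_two.trans_lt hF) (a := a) (by simp)
    (fun x => ?_) ?_
  · simp only [Finset.mem_insert, Finset.mem_singleton, σ.injective.eq_iff]
    have : σ (σ x) = a ↔ x = σ (σ a) := by
      rw [← σ.injective.eq_iff (b := σ (σ a)), ← σ.injective.eq_iff (b := σ (σ (σ a))), h4]
    rw [this, or_comm]
  · simp [ha, h2.2]

/-- The loop joins `a` to `σ³ a`. Smoothing straightens it into a single edge from `τ (σ a)` to `τ
(σ (σ a))`. -/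
theorem IsCurve.detachable_of_loop [Fintype F] {n : ℕ} {σ τ : Perm F} (h : IsCurve n σ τ)
    (hF : 4 < Fintype.card F) {a : F} (ha : σ (τ a) = a) : Detachable n σ τ a := by
  classical
  have hσ := h.quartic
  have hτ := h.pairing
  obtain ⟨d1, d2, d3, d4, d5, d6⟩ := hσ.turns.distinct (hσ a).1
  have h4 := (hσ a).2
  have ha' : τ a = σ (σ (σ a)) := σ.injective (by rw [ha, h4])
  have ha3 : τ (σ (σ (σ a))) = a := by rw [← ha', (hτ a).2]
  have hcl : τ (σ a) ≠ σ (σ a) := by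
    intro e
    have e' : τ (σ (σ a)) = σ a := by rw [← e, (hτ _).2]
    have hsub : ({a, σ a, σ (σ a), σ (σ (σ a))} : Finset F).card < Fintype.card F :=
      Finset.card_le_four.trans_lt hF
    refine h.not_closed _ hsub (a := a) (by simp) (fun x => ?_) ?_
    · have := hσ.apply_mem_vert (a := a) (x := x)
      have h2 := hσ.apply_mem_vert (a := a) (x := σ x)
      simp only [mem_vert] at this h2
      simp only [Finset.mem_insert, Finset.mem_singleton]
      rw [h2, this]
    · simp [ha', ha3, e, e']
  have h1 : τ (σ a) ∉ vert σ a := by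
    rintro (e | e | e | e)
    · have := (hτ (σ a)).2; rw [e, ha'] at this; exact d5 this.symm
    · exact (hτ _).1 e
    · exact hcl e
    · have := (hτ (σ a)).2; rw [e, ha3] at this; exact d1 this
  have h2 : τ (σ (σ a)) ∉ vert σ a := by
    rintro (e | e | e | e)
    · have := (hτ (σ (σ a))).2; rw [e, ha'] at this; exact d6 this.symm
    · exact hcl (by rw [← (hτ (σ (σ a))).2, e])
    · exact (hτ _).1 e
    · have := (hτ (σ (σ a))).2; rw [e, ha3] at this; exact d2 this
  obtain ⟨⟨v0, v1⟩, ⟨v2, v3⟩, v4, n1, n2⟩ := extract_loop_values hσ hτ ha' h1 h2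
  have hj : JoinedOn (vert σ a)ᶜ (σ * σ) (extract σ τ a) := by
    intro f hfs hfτ x hx y hy hfx
    have hpq : f (τ (σ (σ a))) ↔ f (τ (σ a)) := by rw [← v2]; exact hfτ _ h1
    -- `f` has the same value at both outer neighbours of the crossing and is extended over it by
    -- that constant.
    have key := h.joined (fun z => if z ∈ vert σ a then f (τ (σ a)) else f z) (fun z _ => ?_)
      (fun z _ => ?_) x trivial y trivial (by simpa [show x ∉ vert σ a from hx] using hfx)
    · simpa [show y ∉ vert σ a from hy] using key
    · simp only [Perm.mul_apply, hσ.apply_mem_vert]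
      by_cases hz : z ∈ vert σ a
      · simp [hz]
      · simp only [hz, if_false]; exact hfs z hz
    · have hV : ∀ z ∈ vert σ a, τ z ∈ vert σ a ∨ f (τ z) = f (τ (σ a)) := by
        rintro z (rfl | rfl | rfl | rfl)
        · left; rw [ha']; simp [mem_vert]
        · right; rfl
        · right; exact propext hpq
        · left; rw [ha3]; simp [mem_vert]
      by_cases hz : z ∈ vert σ a <;> by_cases hz' : τ z ∈ vert σ a
      · simp [hz, hz']
      · have := (hV z hz).resolve_left hz'
        simp [hz, hz', this]
      · have := hV _ hz'
        rw [(hτ z).2] at this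
        have := this.resolve_left hz
        simp [hz, hz', this]
      · simp only [hz, hz', if_false]
        rw [← v4 z hz hz']
        exact hfτ z hz
  refine ⟨extract σ τ a, τ (σ a), 0, ⟨hτ.extract σ a, ⟨v0, v1⟩, hj, ?_⟩,
    Code.loop _ ha' rfl v2.symm v4, by norm_num, fun z hz hz' => v4 z (fun e => hz (Or.inl e))
    (fun e => hz' (Or.inl e))⟩
  have e1 := numCycles_le_smooth σ τ a
  have e2 := numCycles_add_two_le_extract hσ hτ n1 n2
  have e3 := h.faces
  omega

theorem IsCurve.numCycles_smooth_le [Fintype F] {n : ℕ} {σ τ : Perm F} (h : IsCurve n σ τ)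
    (hn : Fintype.card F = 4 * n) {a : F}
    (hc : JoinedOn Set.univ (smoothOpp σ (σ * σ) a) τ) : numCycles (smooth σ a * τ) ≤ n + 1 := by
  have hσ := h.quartic
  have : Nonempty F := ⟨a⟩
  have hpos : 0 < Fintype.card F := Fintype.card_pos
  have h1 := (hσ.turns).ncard_smooth (hσ a).1
  have h2 : {x | σ (σ x) ≠ x}.ncard = 4 * n := by
    have : {x | σ (σ x) ≠ x} = Set.univ := Set.eq_univ_of_forall fun x => (hσ x).1
    rw [this, Set.ncard_univ, Nat.card_eq_fintype_card, hn]
  have := Turns.numCycles_le h.pairing (n - 1) (hσ.turns.smooth (hσ a).1) hc (by omega)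
  omega

theorem IsCurve.numCycles_le [Fintype F] {n : ℕ} {σ τ : Perm F} (h : IsCurve n σ τ) [Nonempty F]
    (hn : Fintype.card F = 4 * n) : numCycles (σ * τ) = n + 2 := by
  have hσ := h.quartic
  have h2 : {x | σ (σ x) ≠ x}.ncard = 4 * n := by
    have : {x | σ (σ x) ≠ x} = Set.univ := Set.eq_univ_of_forall fun x => (hσ x).1
    rw [this, Set.ncard_univ, Nat.card_eq_fintype_card, hn]
  exact le_antisymm (Turns.numCycles_le h.pairing n hσ.turns h.joined h2) h.faces

/-- If the two corners shared a face, the smoothing would lose no face, leaving `n + 2` faces on a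
single curve with `n - 1` crossings, one more than Euler's inequality allows. -/
theorem IsCurve.not_sameCycle_opp [Fintype F] {n : ℕ} {σ τ : Perm F} (h : IsCurve n σ τ)
    (hn : Fintype.card F = 4 * n) {a : F}
    (hc : JoinedOn Set.univ (smoothOpp σ (σ * σ) a) τ) :
    ¬ SameCycle (σ * τ) a (σ (σ a)) := by
  intro hs
  have h1 := numCycles_le_swap_mul_of_sameCycle hs
  have h2 := h.numCycles_smooth_le hn hc
  have h3 := h.faces
  rw [← mul_assoc] at h1
  rw [smooth] at h2
  omega

/-- The old face of `a`, with its visits to the crossing skipped, is a stretch of the merged face.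
Hence the second reattachment place is at most `d - 2` steps beyond `σ (τ a)`, where `d` is the old
degree. -/
theorem IsCurve.exists_iterate_extract [Fintype F] {n : ℕ} {σ τ : Perm F} (h : IsCurve n σ τ)
    (hn : Fintype.card F = 4 * n) {a : F}
    (hc : JoinedOn Set.univ (smoothOpp σ (σ * σ) a) τ)
    (hl : ∀ x ∈ vert σ a, τ x ∉ vert σ a) :
    ∃ i, i + 2 ≤ Function.minimalPeriod (σ * τ) a ∧
      (σ * extract σ τ a)^[i] (σ (τ a)) = τ (σ (σ (σ a))) := by
  have hσ := h.quartic
  have hτ := h.pairing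
  obtain ⟨-, ⟨v0, v1, v2, v3⟩, v4⟩ := extract_values hσ hτ hl
  have h4 := (hσ a).2
  have l0 := hl a (by simp [mem_vert])
  have l2 := hl (σ (σ a)) (by simp [mem_vert])
  have l3 := hl (σ (σ (σ a))) (by simp [mem_vert])
  set d := Function.minimalPeriod (σ * τ) a with hd
  have hns := h.not_sameCycle_opp hn hc
  have hne0 : ∀ t, 1 ≤ t → t < d → (σ * τ)^[t] a ≠ a := fun t h1 h2 e =>
    Function.not_isPeriodicPt_of_pos_of_lt_minimalPeriod (by omega) h2 e
  have hne2 : ∀ t, (σ * τ)^[t] a ≠ σ (σ a) := fun t e =>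
    hns ⟨t, by rw [← e, zpow_natCast, ← Equiv.Perm.iterate_eq_pow]⟩
  have hV0 : σ (τ a) ∉ vert σ a := fun e => l0 (hσ.apply_mem_vert.1 e)
  have key : ∀ t, 1 ≤ t → t < d → (σ * τ)^[t] a ∉ vert σ a →
      ∃ i, i + 1 ≤ t ∧ (σ * extract σ τ a)^[i] (σ (τ a)) = (σ * τ)^[t] a := by
    intro t
    induction t using Nat.strong_induction_on with
    | _ t ih =>
    intro ht htd hV
    rcases t with _ | _ | r
    · omega
    · exact ⟨0, le_rfl, rfl⟩
    have hstep := Function.iterate_succ_apply' (σ * τ) (r + 1) a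
    have hstep' := Function.iterate_succ_apply' (σ * τ) r a
    rw [Perm.mul_apply] at hstep hstep'
    have hfin : ∀ y i, i + 1 ≤ r + 1 → (σ * extract σ τ a)^[i] (σ (τ a)) = y →
        extract σ τ a y = τ ((σ * τ)^[r + 1] a) →
        ∃ i, i + 1 ≤ r + 1 + 1 ∧ (σ * extract σ τ a)^[i] (σ (τ a)) = (σ * τ)^[r + 2] a := by
      intro y i hi hy hy'
      exact ⟨i + 1, by omega, by
        rw [Function.iterate_succ_apply', hy, Perm.mul_apply, hy', hstep]⟩
    by_cases hz : (σ * τ)^[r + 1] a ∈ vert σ a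
    · have hr : r ≠ 0 := by
        rintro rfl
        exact hV0 hz
      have hback : ∀ w, (σ * τ)^[r + 1] a = σ w → τ w ∉ vert σ a →
          extract σ τ a (τ w) = τ (σ w) →
          ∃ i, i + 1 ≤ r + 1 + 1 ∧ (σ * extract σ τ a)^[i] (σ (τ a)) = (σ * τ)^[r + 2] a := by
        intro w hw hwV hw'
        have hy : (σ * τ)^[r] a = τ w := by
          rw [hstep'] at hw
          rw [← σ.injective hw, (hτ _).2]
        obtain ⟨i, hi, hi'⟩ := ih r (by omega) (by omega) (by omega) (by rw [hy]; exact hwV)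
        exact hfin (τ w) i (by omega) (by rw [hi', hy]) (by rw [hw', hw])
      -- The old face cannot return to `a` early and never meets `σ (σ a)`, which lies in another
      -- face. At `σ a` or `σ³ a` the new face jumps across the crossing.
      rcases hz with e | e | e | e
      · exact absurd e (hne0 _ (by omega) (by omega))
      · exact hback a e l0 v0
      · exact absurd e (hne2 _)
      · exact hback _ e l2 v2
    · obtain ⟨i, hi, hi'⟩ := ih (r + 1) (by omega) (by omega) (by omega) hz
      refine hfin _ i hi hi' (v4 _ hz ?_)
      rw [hstep, hσ.apply_mem_vert] at hV
      exact hV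
  have hdper : (σ * τ)^[d] a = a := Function.iterate_minimalPeriod
  have hd1 : d ≠ 0 := by
    rw [hd]
    exact (Function.minimalPeriod_pos_of_mem_periodicPts
      ((σ * τ).injective.mem_periodicPts a)).ne'
  obtain ⟨e, he⟩ := Nat.exists_eq_succ_of_ne_zero hd1
  rw [he, Function.iterate_succ_apply', Perm.mul_apply] at hdper
  have hlast : (σ * τ)^[e] a = τ (σ (σ (σ a))) := by
    have : τ ((σ * τ)^[e] a) = σ (σ (σ a)) := σ.injective (by rw [hdper, h4])
    rw [← this, (hτ _).2]
  have he1 : e ≠ 0 := by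
    rintro rfl
    exact l3 (by rw [← hlast]; simp [mem_vert])
  obtain ⟨i, hi, hi'⟩ := key e (by omega) (by omega) (by rw [hlast]; exact l3)
  exact ⟨i, by omega, by rw [hi', hlast]⟩

theorem IsCurve.detachable_of_corner [Fintype F] {n : ℕ} {σ τ : Perm F} (h : IsCurve n σ τ)
    (hn : Fintype.card F = 4 * n) {a : F}
    (hc : JoinedOn Set.univ (smoothOpp σ (σ * σ) a) τ)
    (hl : ∀ x ∈ vert σ a, τ x ∉ vert σ a) (hd : Function.minimalPeriod (σ * τ) a ≤ 12) :
    Detachable n σ τ a := by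
  classical
  have hσ := h.quartic
  have hτ := h.pairing
  obtain ⟨i, hi, hi'⟩ := h.exists_iterate_extract hn hc hl
  obtain ⟨⟨u0, u1, u2, u3⟩, ⟨v0, v1, v2, v3⟩, v4⟩ := extract_values hσ hτ hl
  obtain ⟨n1, n2⟩ := extract_nondegenerate hσ hτ hl
  obtain ⟨q0, q1, q2, q3, q4⟩ := smoothOpp_apply hσ.turns (hσ a).1
  obtain ⟨d1, d2, d3, d4, d5, d6⟩ := hσ.turns.distinct (hσ a).1
  have l0 := hl a (by simp [mem_vert])
  have l2 := hl (σ (σ a)) (by simp [mem_vert])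
  have hj : JoinedOn (vert σ a)ᶜ (σ * σ) (extract σ τ a) := by
    intro f hfs hfτ x hx y hy hfx
    have h01 : f (τ (σ a)) ↔ f (τ a) := by rw [← v0]; exact hfτ _ l0
    have h23 : f (τ (σ (σ (σ a)))) ↔ f (τ (σ (σ a))) := by rw [← v2]; exact hfτ _ l2
    -- Each flag of the crossing inherits the value of its partner, which makes `f` an invariant of
    -- the smoothed curve.
    have key := hc (fun z => if z ∈ vert σ a then f (τ z) else f z) (fun z _ => ?_)
      (fun z _ => ?_) x trivial y trivial (by simpa [show x ∉ vert σ a from hx] using hfx)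
    · simpa [show y ∉ vert σ a from hy] using key
    · by_cases hz : z ∈ vert σ a
      · rcases hz with rfl | rfl | rfl | rfl
        · rw [q0]; simp [mem_vert, h01]
        · rw [q1]; simp [mem_vert, h01]
        · rw [q2]; simp [mem_vert, h23]
        · rw [q3]; simp [mem_vert, h23]
      · have hz0 := hz
        simp only [mem_vert, not_or] at hz
        rw [q4 z hz.1 hz.2.1 hz.2.2.1 hz.2.2.2]
        have : (σ * σ) z ∉ vert σ a := by
          rw [Perm.mul_apply, hσ.apply_mem_vert, hσ.apply_mem_vert]; exact hz0
        simp only [hz0, this, if_false]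
        exact hfs z hz0
    · by_cases hz : z ∈ vert σ a
      · simp [hz, hl z hz]
      · by_cases hz' : τ z ∈ vert σ a
        · simp [hz, hz', (hτ z).2]
        · simp only [hz, hz', if_false]
          rw [← v4 z hz hz']
          exact hfτ z hz
  refine ⟨extract σ τ a, τ a, i + 2, ⟨hτ.extract σ a, ⟨u0, u2⟩, hj, ?_⟩,
    Code.corner _ _ rfl v0.symm (by rw [hi', v3]) hi'.symm v4, by omega,
    fun z hz hz' => v4 z (fun e => hz (Or.inl e)) (fun e => hz' (Or.inl e))⟩
  have e1 := numCycles_le_smooth σ τ a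
  have e2 := numCycles_add_two_le_extract hσ hτ n1 n2
  have e3 := h.faces
  omega

end Detach

/-! ### Removal of a crossing between two opposite bigons -/

section Bigons

variable {F : Type*}

theorem IsQuartic.vert_apply {σ : Perm F} (h : IsQuartic σ) (a : F) :
    vert σ (σ a) = vert σ a := by
  ext x
  simp only [mem_vert, (h a).2]
  tauto

/-- The edges at two consecutive bigons. -/
theorem bigon_edges {σ τ : Perm F} (hσ : IsQuartic σ) (hτ : IsPairing τ) {a : F}
    (hb : σ (τ (σ (τ a))) = a) : τ (σ (τ a)) = σ (σ (σ a)) ∧ τ (σ (σ (σ a))) = σ (τ a) := by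
  have h1 : τ (σ (τ a)) = σ (σ (σ a)) := σ.injective (by rw [hb, (hσ a).2])
  exact ⟨h1, by rw [← h1, (hτ _).2]⟩

/-- If both bigons led to one crossing, the two crossings would use up all their edges and form the
whole curve; the other relative positions are contradictory. -/
theorem IsCurve.bigon_notMem [Fintype F] {n : ℕ} {σ τ : Perm F} (h : IsCurve n σ τ)
    (hF : 8 < Fintype.card F) {a : F} (hb : σ (τ (σ (τ a))) = a)
    (hb' : σ (τ (σ (τ (σ (σ a))))) = σ (σ a)) : τ a ∉ vert σ (τ (σ (σ a))) := by
  classical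
  have hσ := h.quartic
  have hτ := h.pairing
  obtain ⟨d1, d2, d3, d4, d5, d6⟩ := hσ.turns.distinct (hσ a).1
  obtain ⟨b1, b2⟩ := bigon_edges hσ hτ hb
  obtain ⟨b3, b4⟩ := bigon_edges hσ hτ hb'
  rw [(hσ a).2] at b3 b4
  have hu := (hτ a).2
  have hw := (hτ (σ (σ a))).2
  generalize τ a = u at *
  generalize hwdef : τ (σ (σ a)) = w at *
  rintro (rfl | rfl | rfl | rfl)
  · exact d2 (hu.symm.trans hw)
  · exact d1 (hu.symm.trans b3)
  · have hV := fun x => hσ.apply_mem_vert (a := a) (x := x)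
    have hW := fun x => hσ.apply_mem_vert (a := w) (x := x)
    simp only [mem_vert] at hV hW
    refine h.not_closed ({a, σ a, σ (σ a), σ (σ (σ a))} ∪ {w, σ w, σ (σ w), σ (σ (σ w))})
      ((Finset.card_union_le _ _).trans_lt ?_) (a := a) (by simp) (fun x => ?_) ?_
    · exact (Nat.add_le_add Finset.card_le_four Finset.card_le_four).trans_lt hF
    · simp only [Finset.mem_union, Finset.mem_insert, Finset.mem_singleton]
      rw [hV, hV, hW, hW]
    · have hu' : τ a = σ (σ w) := by rw [← hu, (hτ _).2]
      simp [hu, hw, b1, b2, b3, b4, hwdef, hu']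
  · rw [(hσ w).2] at b1
    exact d6 (hw.symm.trans b1)

/-- The vertex of `a` is joined by bigons to the vertices of `u` and `w`, and the vertex of `w` has
no loop. -/
structure BigonChain (σ τ : Perm F) (a u w : F) : Prop where
  u0 : τ a = u
  u1 : τ u = a
  u2 : τ (σ u) = σ (σ (σ a))
  u3 : τ (σ (σ (σ a))) = σ u
  w0 : τ (σ (σ a)) = w
  w1 : τ w = σ (σ a)
  w2 : τ (σ w) = σ a
  w3 : τ (σ a) = σ w
  uV : u ∉ vert σ a
  uW : u ∉ vert σ w
  VW : ∀ x, x ∈ vert σ w → x ∉ vert σ a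
  cV : τ (σ (σ w)) ∉ vert σ a
  dV : τ (σ (σ (σ w))) ∉ vert σ a
  cW : τ (σ (σ w)) ∉ vert σ w
  dW : τ (σ (σ (σ w))) ∉ vert σ w

theorem IsCurve.bigonChain [Fintype F] {n : ℕ} {σ τ : Perm F} (h : IsCurve n σ τ)
    (hF : 8 < Fintype.card F) {a : F} (hl : ∀ x ∈ vert σ a, τ x ∉ vert σ a)
    (hb : σ (τ (σ (τ a))) = a) (hb' : σ (τ (σ (τ (σ (σ a))))) = σ (σ a))
    (hc : τ (σ (σ (τ (σ (σ a))))) ≠ σ (σ (σ (τ (σ (σ a)))))) :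
    BigonChain σ τ a (τ a) (τ (σ (σ a))) := by
  have hσ := h.quartic
  have hτ := h.pairing
  have huW := h.bigon_notMem hF hb hb'
  obtain ⟨b1, b2⟩ := bigon_edges hσ hτ hb
  obtain ⟨b3, b4⟩ := bigon_edges hσ hτ hb'
  rw [(hσ a).2] at b3 b4
  have hu := (hτ a).2
  have hw := (hτ (σ (σ a))).2
  have huV : τ a ∉ vert σ a := hl a (by simp [mem_vert])
  have hwV : τ (σ (σ a)) ∉ vert σ a := hl _ (by simp [mem_vert])
  generalize hudef : τ a = u at *
  generalize hwdef : τ (σ (σ a)) = w at *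
  have hV := fun x => hσ.apply_mem_vert (a := a) (x := x)
  have hW := fun x => hσ.apply_mem_vert (a := w) (x := x)
  obtain ⟨e1, e2, e3, e4, e5, e6⟩ := hσ.turns.distinct (hσ w).1
  have hVW : ∀ x, x ∈ vert σ w → x ∉ vert σ a := by
    rintro x (rfl | rfl | rfl | rfl)
    · exact hwV
    · rwa [hV]
    · rwa [hV, hV]
    · rwa [hV, hV, hV]
  have hin : ∀ x ∈ vert σ a, τ x = u ∨ τ x = σ w ∨ τ x = w ∨ τ x = σ u := by
    rintro x (rfl | rfl | rfl | rfl)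
    · exact Or.inl hudef
    · exact Or.inr (Or.inl b4)
    · exact Or.inr (Or.inr (Or.inl hwdef))
    · exact Or.inr (Or.inr (Or.inr b2))
  have hσu : σ u ∉ vert σ w := by rwa [hW]
  have hcV : τ (σ (σ w)) ∉ vert σ a := by
    intro hx
    have := hin _ hx
    rw [(hτ _).2] at this
    rcases this with e | e | e | e
    · exact huW (by rw [← e]; simp [mem_vert])
    · exact e4 e.symm
    · exact e2 e.symm
    · exact hσu (by rw [← e]; simp [mem_vert])
  have hdV : τ (σ (σ (σ w))) ∉ vert σ a := by
    intro hx
    have := hin _ hx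
    rw [(hτ _).2] at this
    rcases this with e | e | e | e
    · exact huW (by rw [← e]; simp [mem_vert])
    · exact e5 e.symm
    · exact e3 e.symm
    · exact hσu (by rw [← e]; simp [mem_vert])
  have hcW : τ (σ (σ w)) ∉ vert σ w := by
    rintro (e | e | e | e)
    · exact hVW (σ (σ w)) (by simp [mem_vert]) (by rw [← (hτ (σ (σ w))).2, e, hw]; simp [mem_vert])
    · exact hVW (σ (σ w)) (by simp [mem_vert]) (by rw [← (hτ (σ (σ w))).2, e, b3]; simp [mem_vert])
    · exact (hτ _).1 e
    · exact hc e
  have hdW : τ (σ (σ (σ w))) ∉ vert σ w := by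
    rintro (e | e | e | e)
    · exact hVW (σ (σ (σ w))) (by simp [mem_vert])
        (by rw [← (hτ (σ (σ (σ w)))).2, e, hw]; simp [mem_vert])
    · exact hVW (σ (σ (σ w))) (by simp [mem_vert])
        (by rw [← (hτ (σ (σ (σ w)))).2, e, b3]; simp [mem_vert])
    · exact hc (by conv_lhs => rw [← e, (hτ _).2])
    · exact (hτ _).1 e
  exact ⟨hudef, hu, b1, b2, hwdef, hw, b3, b4, huV, huW, hVW, hcV, hdV, hcW, hdW⟩

/-- The strands through `u, a, σ² a, w, σ² w` and through `σ u, σ³ a, σ a, σ w, σ³ w` cross twice.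
Pulling them apart replaces each by one edge and does not change how the curve is traversed. -/
theorem BigonChain.joinedOn {σ τ τ4 : Perm F} {a u w : F} (hσ : IsQuartic σ) (hτ : IsPairing τ)
    (hb : BigonChain σ τ a u w) (hjoin : JoinedOn Set.univ (σ * σ) τ)
    (w0 : τ4 u = τ (σ (σ w))) (w3 : τ4 (σ u) = τ (σ (σ (σ w))))
    (hout : ∀ z, z ∉ vert σ a ∪ vert σ w → τ z ∉ vert σ a ∪ vert σ w → τ4 z = τ z) :
    JoinedOn (vert σ a ∪ vert σ w)ᶜ (σ * σ) τ4 := by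
  classical
  obtain ⟨hudef, hu, b1, b2, hwdef, hw, b3, b4, huV, huW, hVW, hcV, hdV, hcW, hdW⟩ := hb
  have hV := fun x => hσ.apply_mem_vert (a := a) (x := x)
  have hW := fun x => hσ.apply_mem_vert (a := w) (x := x)
  obtain ⟨d1, d2, d3, d4, d5, d6⟩ := hσ.turns.distinct (hσ a).1
  obtain ⟨e1, e2, e3, e4, e5, e6⟩ := hσ.turns.distinct (hσ w).1
  intro f hfs hfτ x hx y hy hfx
  have huA : u ∈ (vert σ a ∪ vert σ w)ᶜ := fun h => h.elim huV huW
  have huA' : σ u ∈ (vert σ a ∪ vert σ w)ᶜ := fun h =>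
    h.elim (fun h => huV ((hV u).1 h)) (fun h => huW ((hW u).1 h))
  have k1 : f (τ (σ (σ w))) ↔ f u := by rw [← w0]; exact hfτ _ huA
  have k2 : f (τ (σ (σ (σ w)))) ↔ f (σ u) := by rw [← w3]; exact hfτ _ huA'
  -- `f'` is constant along each of the two strands.
  let f' : F → Prop := fun z => if z = a ∨ z = σ (σ a) ∨ z = w ∨ z = σ (σ w) then f u else
    if z = σ a ∨ z = σ (σ (σ a)) ∨ z = σ w ∨ z = σ (σ (σ w)) then f (σ u) else f z
  have hne : ∀ p ∈ vert σ a, ∀ q ∈ vert σ w, p ≠ q := fun p hp q hq e => hVW q hq (e ▸ hp)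
  have ha0 : a ∈ vert σ a := by simp [mem_vert]
  have ha1 : σ a ∈ vert σ a := by simp [mem_vert]
  have ha2 : σ (σ a) ∈ vert σ a := by simp [mem_vert]
  have ha3 : σ (σ (σ a)) ∈ vert σ a := by simp [mem_vert]
  have hw0 : w ∈ vert σ w := by simp [mem_vert]
  have hw1 : σ w ∈ vert σ w := by simp [mem_vert]
  have hw2 : σ (σ w) ∈ vert σ w := by simp [mem_vert]
  have hw3 : σ (σ (σ w)) ∈ vert σ w := by simp [mem_vert]
  have f0 : f' a = f u := by simp [f']
  have f1 : f' (σ a) = f (σ u) := by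
    simp [f', d1.symm, hne _ ha1 _ hw0, hne _ ha1 _ hw2, (hσ.turns.ne _).symm]
  have f2 : f' (σ (σ a)) = f u := by simp [f']
  have f3 : f' (σ (σ (σ a))) = f (σ u) := by
    simp [f', d3.symm, d6.symm, hne _ ha3 _ hw0, hne _ ha3 _ hw2]
  have f4 : f' w = f u := by simp [f']
  have f5 : f' (σ w) = f (σ u) := by
    simp [f', e1.symm, (hne _ ha0 _ hw1).symm, (hne _ ha2 _ hw1).symm, (hσ.turns.ne _).symm]
  have f6 : f' (σ (σ w)) = f u := by simp [f']
  have f7 : f' (σ (σ (σ w))) = f (σ u) := by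
    simp [f', e3.symm, e6.symm, (hne _ ha0 _ hw3).symm, (hne _ ha2 _ hw3).symm]
  have f8 : ∀ z ∈ (vert σ a ∪ vert σ w)ᶜ, f' z = f z := by
    intro z hz
    simp only [Set.mem_compl_iff, Set.mem_union, mem_vert, not_or] at hz
    simp [f', hz]
  have hin2 : ∀ z ∈ vert σ a ∪ vert σ w, f' (τ z) = f' z := by
    rintro z ((rfl | rfl | rfl | rfl) | (rfl | rfl | rfl | rfl))
    · rw [hudef, f0, f8 _ huA]
    · rw [b4, f1, f5]
    · rw [hwdef, f2, f4]
    · rw [b2, f3, f8 _ huA']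
    · rw [hw, f2, f4]
    · rw [b3, f1, f5]
    · rw [f6, f8 _ (fun e => e.elim hcV hcW)]; exact propext k1
    · rw [f7, f8 _ (fun e => e.elim hdV hdW)]; exact propext k2
  have key := hjoin f' (fun z _ => ?_) (fun z _ => ?_) x trivial y trivial
    (by rw [f8 x hx]; exact hfx)
  · rwa [f8 y hy] at key
  · rw [Perm.mul_apply]
    by_cases hz : z ∈ vert σ a ∪ vert σ w
    · rcases hz with (rfl | rfl | rfl | rfl) | (rfl | rfl | rfl | rfl)
      · rw [f0, f2]
      · rw [f1, f3]
      · rw [(hσ a).2, f0, f2]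
      · rw [(hσ (σ a)).2, f1, f3]
      · rw [f4, f6]
      · rw [f5, f7]
      · rw [(hσ w).2, f4, f6]
      · rw [(hσ (σ w)).2, f5, f7]
    · have hz2 : σ (σ z) ∈ (vert σ a ∪ vert σ w)ᶜ := by
        intro e
        rw [Set.mem_union, hV, hV, hW, hW] at e
        exact hz e
      rw [f8 _ hz2, f8 _ hz]
      exact hfs z hz
  · by_cases hz : z ∈ vert σ a ∪ vert σ w
    · rw [hin2 z hz]
    by_cases hz' : τ z ∈ vert σ a ∪ vert σ w
    · have := hin2 _ hz'
      rw [(hτ z).2] at this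
      rw [this]
    · rw [f8 _ hz', f8 _ hz, ← hout z hz hz']
      exact hfτ z hz
variable [DecidableEq F]

/-- The crossing of `a` is extracted, then that of `w` from the corner `σ w`, so that the two
smoothings together pull the strands apart. Each extraction gains at least `3 - 1` faces. -/
theorem BigonChain.exists_extract [Finite F] {σ τ : Perm F} {a u w : F} (hσ : IsQuartic σ)
    (hτ : IsPairing τ) (hb : BigonChain σ τ a u w) (hl : ∀ x ∈ vert σ a, τ x ∉ vert σ a) :
    ∃ τ4, IsPairing τ4 ∧ Floats σ τ4 a ∧ Floats σ τ4 (σ w) ∧ τ4 u = τ (σ (σ w)) ∧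
      τ4 (τ (σ (σ w))) = u ∧ τ4 (σ u) = τ (σ (σ (σ w))) ∧
      (∀ z, z ∉ vert σ a ∪ vert σ w → τ z ∉ vert σ a ∪ vert σ w → τ4 z = τ z) ∧
      numCycles (σ * τ) + 4 ≤ numCycles (σ * τ4) := by
  obtain ⟨hudef, hu, b1, b2, hwdef, hw, b3, b4, huV, huW, hVW, hcV, hdV, hcW, hdW⟩ := hb
  obtain ⟨⟨x0, x1, x2, x3⟩, ⟨v0, v1, v2, v3⟩, v4⟩ := extract_values hσ hτ hl
  obtain ⟨n1, n2⟩ := extract_nondegenerate hσ hτ hl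
  have z1 := numCycles_add_two_le_extract hσ hτ n1 n2
  have hτ2 := hτ.extract σ a
  rw [hudef, b4] at v0 v1
  rw [hwdef, b2] at v2 v3
  set τ2 := extract σ τ a with hτ2def
  have hvW := hσ.vert_apply w
  have hwf := (hσ w).2
  have hσu : σ u ∉ vert σ w := fun h => huW (hσ.apply_mem_vert.1 h)
  have t2c : τ2 (σ (σ w)) = τ (σ (σ w)) := v4 _ (hVW _ (by simp [mem_vert])) hcV
  have t2d : τ2 (σ (σ (σ w))) = τ (σ (σ (σ w))) := v4 _ (hVW _ (by simp [mem_vert])) hdV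
  have hl2 : ∀ x ∈ vert σ (σ w), τ2 x ∉ vert σ (σ w) := by
    rw [hvW]
    rintro x (rfl | rfl | rfl | rfl)
    · rw [v2]; exact hσu
    · rw [v1]; exact huW
    · rw [t2c]; exact hcW
    · rw [t2d]; exact hdW
  obtain ⟨⟨y0, y1, y2, y3⟩, ⟨w0, w1, w2, w3⟩, w4⟩ := extract_values hσ hτ2 hl2
  obtain ⟨m1, m2⟩ := extract_nondegenerate hσ hτ2 hl2
  have z2 := numCycles_add_two_le_extract hσ hτ2 m1 m2
  have hτ4 := hτ2.extract σ (σ w)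
  set τ4 := extract σ τ2 (σ w) with hτ4def
  rw [v1, t2c] at w0
  rw [v1, t2c] at w1
  rw [hwf, v2, t2d] at w2
  rw [hwf, v2, t2d] at w3
  rw [hvW] at w4
  have hf4 : Floats σ τ4 (σ w) := ⟨y0, y2⟩
  have hout : ∀ z, z ∉ vert σ a ∪ vert σ w → τ z ∉ vert σ a ∪ vert σ w → τ4 z = τ z := by
    intro z hz hz'
    simp only [Set.mem_union, not_or] at hz hz'
    have := v4 z hz.1 hz'.1
    rw [← this]
    exact w4 z hz.2 (by rw [this]; exact hz'.2)
  have hinV : ∀ x ∈ vert σ a, τ4 x = τ2 x := by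
    intro x hx
    have h2 : τ2 x ∈ vert σ a := (Floats.mem_vert_iff hτ2 ⟨x0, x2⟩).2 hx
    exact w4 x (fun e => hVW x e hx) (fun e => hVW _ e h2)
  have hfV : Floats σ τ4 a := ⟨by rw [hinV a (by simp [mem_vert]), x0],
    by rw [hinV _ (by simp [mem_vert]), x2]⟩
  refine ⟨τ4, hτ4, hfV, hf4, w0, w1, w3, hout, ?_⟩
  have z0 := numCycles_le_smooth σ τ a
  have z4 := numCycles_le_smooth σ τ2 (σ w)
  omega

/-- With both crossings detached, that of `w` returns as a kink on the edge from `u` to `τ (σ (σ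
w))`. The face count is at least `(n + 2) + 4 - 2`. -/
theorem IsCurve.detachable_of_bigonChain [Fintype F] {n : ℕ} {σ τ : Perm F} (h : IsCurve n σ τ)
    {a u w : F} (hb : BigonChain σ τ a u w) (hl : ∀ x ∈ vert σ a, τ x ∉ vert σ a) :
    Detachable n σ τ a := by
  have hσ := h.quartic
  have hτ := h.pairing
  obtain ⟨τ4, hτ4, hfV, hf4, w0, w1, w3, hout, hz⟩ := hb.exists_extract hσ hτ hl
  have hj := hb.joinedOn hσ hτ h.joined w0 w3 hout
  obtain ⟨hudef, hu, b1, b2, hwdef, hw, b3, b4, huV, huW, hVW, hcV, hdV, hcW, hdW⟩ := hb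
  have hvW := hσ.vert_apply w
  have hwf := (hσ w).2
  have hσu : σ u ∉ vert σ w := fun h => huW (hσ.apply_mem_vert.1 h)
  have hcb : τ (σ (σ w)) ∉ vert σ (σ w) := by rwa [hvW]
  have hτ5 := hτ4.kink σ (σ w) (τ (σ (σ w)))
  obtain ⟨s0, s1, s2, s3, s4, s5, s6⟩ := kink_values hσ hτ4 hf4 hcb
  have z3 := numCycles_le_kink hσ hτ4 hf4 hcb
  have hA : Disjoint (vert σ a ∪ vert σ w)ᶜ (vert σ (σ w)) := by
    rw [hvW, Set.disjoint_left]
    exact fun x hx hx' => hx (Or.inr hx')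
  have hj5 := joinedOn_kink hσ hτ4 hf4 hA (b := τ (σ (σ w))) (fun e => e.elim hcV hcW) hj
    (fun x hx hx' => by
      rcases hx' with e | e
      · exact hx (Or.inl ((Floats.mem_vert_iff hτ4 hfV).1 e))
      · rw [← hvW] at e
        exact hx (Or.inr (by rw [← hvW]; exact (Floats.mem_vert_iff hτ4 hf4).1 e)))
  rw [hvW] at hj5
  have hset : (vert σ a ∪ vert σ w)ᶜ ∪ vert σ w = (vert σ a)ᶜ := by
    ext x
    have := hVW x
    by_cases h1 : x ∈ vert σ w <;> by_cases h2 : x ∈ vert σ a <;> simp_all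
  rw [hset] at hj5
  rw [w1] at s0 s1 s6
  rw [hvW] at s6
  rw [hwf] at s4 s5
  set τ5 := kink σ τ4 (σ w) (τ (σ (σ w))) with hτ5def
  have hne5 : ∀ z, z ∉ vert σ w → z ≠ τ (σ (σ w)) → z ≠ u → τ5 z = τ4 z := s6
  have hσuc : τ5 (σ u) = τ (σ (σ (σ w))) := by
    rw [hne5 _ hσu ?_ (hσ.turns.ne u), w3]
    intro e
    have : τ (σ u) = σ (σ w) := by rw [e, (hτ _).2]
    rw [b1] at this
    exact hVW (σ (σ w)) (by simp [mem_vert]) (by rw [← this]; simp [mem_vert])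
  have hout5 : ∀ z, z ∉ vert σ a ∪ vert σ w → τ z ∉ vert σ a ∪ vert σ w → τ5 z = τ z := by
    intro z hz hz'
    rw [← hout z hz hz']
    refine hne5 z (fun e => hz (Or.inr e)) ?_ ?_
    · rintro rfl
      exact hz' (Or.inr (by rw [(hτ _).2]; simp [mem_vert]))
    · rintro rfl
      exact hz' (Or.inl (by rw [hu]; simp [mem_vert]))
  have hin5 : ∀ x ∈ vert σ a, τ5 x = τ4 x := fun x hx =>
    hne5 x (fun e => hVW x e hx) (fun e => hcV (e ▸ hx)) (fun e => huV (e ▸ hx))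
  refine ⟨τ5, σ w, 1, ⟨hτ5, ⟨?_, ?_⟩, hj5, ?_⟩, Code.bigons _ ?_ b4 ?_ ?_ ?_ ?_ ?_, by norm_num, ?_⟩
  · rw [hin5 a (by simp [mem_vert])]; exact hfV.1
  · rw [hin5 _ (by simp [mem_vert])]; exact hfV.2
  · have z5 := h.faces
    omega
  · rw [s0, hudef]
  · rw [hwf, hwdef]
  · rw [b2, s0]
  · rw [hwf, s4]
  · rw [s0, hσuc]
  · rw [hvW]; exact hout5
  · rw [hwdef]; exact hout5

end Bigons

/-! ### Face degrees as minimal periods -/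

section Degrees

variable {F : Type*}

theorem minimalPeriod_pos [Finite F] (φ : Perm F) (x : F) : 0 < Function.minimalPeriod φ x :=
  Function.minimalPeriod_pos_of_mem_periodicPts (φ.injective.mem_periodicPts x)

theorem ncard_sameCycle [Finite F] (φ : Perm F) (x : F) :
    {y | SameCycle φ x y}.ncard = Function.minimalPeriod φ x := by
  have h1 : {y | SameCycle φ x y} =
      (fun m => φ^[m] x) '' Set.Iio (Function.minimalPeriod φ x) := by
    ext y
    constructor
    · intro h
      obtain ⟨i, hi⟩ := h.exists_nat_pow_eq
      refine ⟨i % Function.minimalPeriod φ x, Nat.mod_lt _ (minimalPeriod_pos φ x), ?_⟩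
      simp only
      rw [Function.iterate_mod_minimalPeriod_eq, Equiv.Perm.iterate_eq_pow, hi]
    · rintro ⟨i, -, rfl⟩
      exact ⟨i, by rw [zpow_natCast, ← Equiv.Perm.iterate_eq_pow]⟩
  rw [h1, Function.iterate_injOn_Iio_minimalPeriod.ncard_image,
    Set.ncard_eq_toFinset_card' ]
  simp

theorem SameCycle.minimalPeriod_eq [Finite F] {φ : Perm F} {x y : F} (h : SameCycle φ x y) :
    Function.minimalPeriod φ x = Function.minimalPeriod φ y := by
  rw [← ncard_sameCycle, ← ncard_sameCycle]
  congr 1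
  ext z
  exact ⟨fun h2 => h.symm.trans h2, fun h2 => h.trans h2⟩

/-- A cycle of length `d` contributes `d` terms `1 / d`. -/
theorem sum_inv_minimalPeriod [Fintype F] (φ : Perm F) :
    ∑ x, (1 : ℚ) / Function.minimalPeriod φ x = numCycles φ := by
  classical
  have := Fintype.ofFinite (Quotient (SameCycle.setoid φ))
  rw [numCycles, Nat.card_eq_fintype_card,
    ← Finset.sum_fiberwise (g := Quotient.mk (SameCycle.setoid φ)) (s := Finset.univ),
    Fintype.card, Finset.card_eq_sum_ones, Nat.cast_sum, Nat.cast_one]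
  refine Finset.sum_congr rfl fun c _ => ?_
  induction c using Quotient.inductionOn with
  | _ x =>
    have hx : ∀ y ∈ Finset.univ.filter
        (fun y => Quotient.mk (SameCycle.setoid φ) y = Quotient.mk (SameCycle.setoid φ) x),
        (1 : ℚ) / Function.minimalPeriod φ y = 1 / Function.minimalPeriod φ x := by
      intro y hy
      have : SameCycle φ y x := Quotient.exact (Finset.mem_filter.1 hy).2
      rw [SameCycle.minimalPeriod_eq this]
    rw [Finset.sum_congr rfl hx, Finset.sum_const]
    have hc : (Finset.univ.filter
        (fun y => Quotient.mk (SameCycle.setoid φ) y = Quotient.mk (SameCycle.setoid φ) x)).card =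
        Function.minimalPeriod φ x := by
      rw [← ncard_sameCycle, ← Set.ncard_coe_finset]
      congr 1
      ext y
      simp only [Finset.coe_filter, Finset.mem_univ, true_and]
      exact ⟨fun h => (Quotient.exact h : SameCycle φ y x).symm,
        fun h => Quotient.sound (s := SameCycle.setoid φ) (SameCycle.symm h)⟩
    rw [hc, nsmul_eq_mul]
    have := minimalPeriod_pos φ x
    field_simp

end Degrees

/-! ### A positive proportion of flags is detachable -/

section Count

variable {F : Type*} [DecidableEq F]

theorem smoothOpp_opp {σ : Perm F} (hσ : IsQuartic σ) (a : F) :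
    smoothOpp σ (σ * σ) (σ (σ a)) = smoothOpp σ (σ * σ) a := by
  obtain ⟨q0, q1, q2, q3, q4⟩ := smoothOpp_apply hσ.turns (hσ a).1
  obtain ⟨p0, p1, p2, p3, p4⟩ := smoothOpp_apply hσ.turns (hσ (σ (σ a))).1
  simp only [(hσ a).2] at p2 p3 p4
  ext x
  by_cases hx : x ∈ vert σ a
  · rcases hx with rfl | rfl | rfl | rfl
    · rw [p2, q0]
    · rw [p3, q1]
    · rw [p0, q2]
    · rw [p1, q3]
  · simp only [mem_vert, not_or] at hx
    rw [q4 x hx.1 hx.2.1 hx.2.2.1 hx.2.2.2, p4 x hx.2.2.1 hx.2.2.2 hx.1 hx.2.1]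

theorem IsCurve.no_loop [Fintype F] {n : ℕ} {σ τ : Perm F} (h : IsCurve n σ τ)
    (hF : 2 < Fintype.card F) {a : F} (hm : ∀ x ∈ vert σ a, σ (τ x) ≠ x) :
    ∀ x ∈ vert σ a, τ x ∉ vert σ a := by
  have hσ := h.quartic
  have key : ∀ x ∈ vert σ a, τ x ≠ σ x ∧ τ x ≠ σ (σ x) ∧ τ x ≠ σ (σ (σ x)) := by
    intro x hx
    refine ⟨fun e => hm (σ x) (hσ.apply_mem_vert.2 hx) ?_, h.opp_ne hF x, fun e => hm x hx ?_⟩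
    · rw [← e, (h.pairing x).2, e]
    · rw [e, (hσ x).2]
  intro x hx hx'
  have hxx := key x hx
  have hn := (h.pairing x).1
  have h4 := (hσ a).2
  rw [mem_vert] at hx'
  rcases hx with rfl | rfl | rfl | rfl <;>
    [skip; simp only [h4] at hxx; simp only [h4] at hxx; simp only [h4] at hxx] <;> tauto

/-- The bigon removal fails only if the neighbour on the chosen side carries a loop. If both
neighbours do, the three crossings are a whole curve with at most 12 flags. -/
theorem IsCurve.detachable_or_detachable [Fintype F] {n : ℕ} {σ τ : Perm F} (h : IsCurve n σ τ)
    (hF : 12 < Fintype.card F) {a : F} (hl : ∀ x ∈ vert σ a, τ x ∉ vert σ a)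
    (hb : σ (τ (σ (τ a))) = a) (hb' : σ (τ (σ (τ (σ (σ a))))) = σ (σ a)) :
    Detachable n σ τ a ∨ Detachable n σ τ (σ (σ a)) := by
  have hσ := h.quartic
  have hτ := h.pairing
  by_cases hc : τ (σ (σ (τ (σ (σ a))))) = σ (σ (σ (τ (σ (σ a)))))
  swap
  · exact Or.inl (h.detachable_of_bigonChain (h.bigonChain (by omega) hl hb hb' hc) hl)
  by_cases hc' : τ (σ (σ (τ a))) = σ (σ (σ (τ a)))
  swap
  · right
    have hv : vert σ (σ (σ a)) = vert σ a := by rw [hσ.vert_apply, hσ.vert_apply]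
    have hl' : ∀ x ∈ vert σ (σ (σ a)), τ x ∉ vert σ (σ (σ a)) := by rwa [hv]
    refine h.detachable_of_bigonChain (h.bigonChain (by omega) hl' hb' ?_ ?_) hl'
    · rw [(hσ a).2, hb]
    · rwa [(hσ a).2]
  exfalso
  obtain ⟨b1, b2⟩ := bigon_edges hσ hτ hb
  obtain ⟨b3, b4⟩ := bigon_edges hσ hτ hb'
  rw [(hσ a).2] at b3 b4
  have hu := (hτ a).2
  have hw := (hτ (σ (σ a))).2
  have c1 := (hτ (σ (σ (τ a)))).2
  have c2 := (hτ (σ (σ (τ (σ (σ a)))))).2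
  rw [hc'] at c1
  rw [hc] at c2
  generalize hudef : τ a = u at *
  generalize hwdef : τ (σ (σ a)) = w at *
  have hV := fun x => hσ.apply_mem_vert (a := a) (x := x)
  have hW := fun x => hσ.apply_mem_vert (a := w) (x := x)
  have hU := fun x => hσ.apply_mem_vert (a := u) (x := x)
  simp only [mem_vert] at hV hW hU
  refine h.not_closed (({a, σ a, σ (σ a), σ (σ (σ a))} ∪ {w, σ w, σ (σ w), σ (σ (σ w))}) ∪
    {u, σ u, σ (σ u), σ (σ (σ u))}) ?_ (a := a) (by simp) (fun x => ?_) ?_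
  · refine lt_of_le_of_lt ((Finset.card_union_le _ _).trans (Nat.add_le_add
      ((Finset.card_union_le _ _).trans (Nat.add_le_add Finset.card_le_four Finset.card_le_four))
      Finset.card_le_four)) hF
  · simp only [Finset.mem_union, Finset.mem_insert, Finset.mem_singleton]
    rw [hV, hV, hW, hW, hU, hU]
  · simp [hu, hw, b1, b2, b3, b4, hwdef, hudef, c1, c2, hc, hc']

/-- The two merged corners have degree at least 13, the other two at least 2 and not both 2, and
`2/13 + 1/2 + 1/3 = 77/78`. With 12 in place of 13 the sum would reach one. -/
theorem IsCurve.sum_inv_le_of_corner [Fintype F] {n : ℕ} {σ τ : Perm F} (h : IsCurve n σ τ)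
    (hn : Fintype.card F = 4 * n) (hn4 : 4 ≤ n) {a : F}
    (hc : JoinedOn Set.univ (smoothOpp σ (σ * σ) a) τ)
    (hd : ∀ x ∈ vert σ a, ¬ Detachable n σ τ x) :
    (1 : ℚ) / Function.minimalPeriod (σ * τ) a + 1 / Function.minimalPeriod (σ * τ) (σ a) +
      1 / Function.minimalPeriod (σ * τ) (σ (σ a)) +
      1 / Function.minimalPeriod (σ * τ) (σ (σ (σ a))) ≤ 77 / 78 := by
  have hσ := h.quartic
  have hm : ∀ x ∈ vert σ a, σ (τ x) ≠ x := fun x hx e =>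
    hd x hx (h.detachable_of_loop (by omega) e)
  have hl := h.no_loop (by omega) hm
  have h0 : 13 ≤ Function.minimalPeriod (σ * τ) a := by
    by_contra hlt
    exact hd a (by simp [mem_vert]) (h.detachable_of_corner hn hc hl (by omega))
  have h2 : 13 ≤ Function.minimalPeriod (σ * τ) (σ (σ a)) := by
    by_contra hlt
    refine hd (σ (σ a)) (by simp [mem_vert]) (h.detachable_of_corner hn ?_ ?_ (by omega))
    · rwa [smoothOpp_opp hσ]
    · rwa [hσ.vert_apply, hσ.vert_apply]
  have hge2 : ∀ x ∈ vert σ a, 2 ≤ Function.minimalPeriod (σ * τ) x := by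
    intro x hx
    have h1 := minimalPeriod_pos (σ * τ) x
    have h3 : Function.minimalPeriod (σ * τ) x ≠ 1 := by
      rw [ne_eq, Function.minimalPeriod_eq_one_iff_isFixedPt]
      exact hm x hx
    omega
  have h1 := hge2 (σ a) (by simp [mem_vert])
  have h3 := hge2 (σ (σ (σ a))) (by simp [mem_vert])
  have h13 : 5 ≤ Function.minimalPeriod (σ * τ) (σ a) +
      Function.minimalPeriod (σ * τ) (σ (σ (σ a))) := by
    by_contra hlt
    have e1 : Function.minimalPeriod (σ * τ) (σ a) = 2 := by omega
    have e3 : Function.minimalPeriod (σ * τ) (σ (σ (σ a))) = 2 := by omega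
    have b1 := Function.iterate_minimalPeriod (f := σ * τ) (x := σ a)
    have b3 := Function.iterate_minimalPeriod (f := σ * τ) (x := σ (σ (σ a)))
    rw [e1] at b1
    rw [e3] at b3
    rcases h.detachable_or_detachable (by omega) (a := σ a) (by rwa [hσ.vert_apply]) b1 b3
      with hh | hh
    · exact hd _ (by simp [mem_vert]) hh
    · exact hd _ (by simp [mem_vert]) hh
  have hinv : ∀ {m k : ℕ}, 0 < k → k ≤ m → (1 : ℚ) / m ≤ 1 / k := fun hk hkm =>
    one_div_le_one_div_of_le (by exact_mod_cast hk) (by exact_mod_cast hkm)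
  have g0 := hinv (by norm_num) h0
  have g2 := hinv (by norm_num) h2
  have g1 := hinv (by norm_num) h1
  have g3 := hinv (by norm_num) h3
  rcases le_or_gt 3 (Function.minimalPeriod (σ * τ) (σ a)) with hh | hh
  · have g1' := hinv (by norm_num) hh
    norm_num at g0 g1' g2 g3 ⊢
    linarith
  · have g3' := hinv (by norm_num) (show 3 ≤ Function.minimalPeriod (σ * τ) (σ (σ (σ a))) by omega)
    norm_num at g0 g1 g2 g3' ⊢
    linarith

theorem IsCurve.sum_inv_le [Fintype F] {n : ℕ} {σ τ : Perm F} (h : IsCurve n σ τ)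
    (hn : Fintype.card F = 4 * n) (hn4 : 4 ≤ n) {a : F}
    (hd : ∀ x ∈ vert σ a, ¬ Detachable n σ τ x) :
    (1 : ℚ) / Function.minimalPeriod (σ * τ) a + 1 / Function.minimalPeriod (σ * τ) (σ a) +
      1 / Function.minimalPeriod (σ * τ) (σ (σ a)) +
      1 / Function.minimalPeriod (σ * τ) (σ (σ (σ a))) ≤ 77 / 78 := by
  have hσ := h.quartic
  rcases hσ.turns.joinedOn_smooth_or h.pairing h.joined (hσ a).1 with hc | hc
  · exact h.sum_inv_le_of_corner hn hn4 hc hd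
  · have := h.sum_inv_le_of_corner hn hn4 hc (by rwa [hσ.vert_apply])
    rw [(hσ a).2] at this
    linarith

/-- A positive proportion of all flags is detachable. -/
theorem IsCurve.le_card_detachable [Fintype F] {n : ℕ} {σ τ : Perm F} (h : IsCurve n σ τ)
    (hn : Fintype.card F = 4 * n) (hn4 : 4 ≤ n) : n ≤ 312 * {a | Detachable n σ τ a}.ncard := by
  classical
  have hσ := h.quartic
  have hne : Nonempty F := Fintype.card_pos_iff.1 (by omega)
  let w : F → ℚ := fun a => 1 / Function.minimalPeriod (σ * τ) a
  let D : F → ℚ := fun a => if Detachable n σ τ a then 1 else 0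
  have hw1 : ∀ a, w a ≤ 1 := fun a => by
    have := minimalPeriod_pos (σ * τ) a
    simp only [w]
    rw [div_le_one (by exact_mod_cast this)]
    exact_mod_cast this
  have hD0 : ∀ a, 0 ≤ D a := fun a => by simp only [D]; split_ifs <;> norm_num
  have hD1 : ∀ a, Detachable n σ τ a → D a = 1 := fun a ha => by simp [D, ha]
  -- Each weight is at most one, so a term 4 covers any crossing with a detachable flag.
  have hle : ∀ a, w a + w (σ a) + w (σ (σ a)) + w (σ (σ (σ a))) ≤
      77 / 78 + 4 * (D a + D (σ a) + D (σ (σ a)) + D (σ (σ (σ a)))) := by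
    intro a
    have p0 := hD0 a
    have p1 := hD0 (σ a)
    have p2 := hD0 (σ (σ a))
    have p3 := hD0 (σ (σ (σ a)))
    by_cases hd : ∀ x ∈ vert σ a, ¬ Detachable n σ τ x
    · have := h.sum_inv_le hn hn4 hd
      simp only [w]
      linarith
    · push Not at hd
      obtain ⟨x, hx, hxd⟩ := hd
      have hx1 := hD1 x hxd
      have q0 := hw1 a
      have q1 := hw1 (σ a)
      have q2 := hw1 (σ (σ a))
      have q3 := hw1 (σ (σ (σ a)))
      rcases hx with rfl | rfl | rfl | rfl <;> linarith
  have hrot : ∀ f : F → ℚ, ∑ a, (f a + f (σ a) + f (σ (σ a)) + f (σ (σ (σ a)))) = 4 * ∑ a, f a := by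
    intro f
    have e1 : ∑ a, f (σ a) = ∑ a, f a := Equiv.sum_comp σ f
    have e2 : ∑ a, f (σ (σ a)) = ∑ a, f a := (Equiv.sum_comp σ (fun a => f (σ a))).trans e1
    have e3 : ∑ a, f (σ (σ (σ a))) = ∑ a, f a :=
      (Equiv.sum_comp σ (fun a => f (σ (σ a)))).trans e2
    rw [Finset.sum_add_distrib, Finset.sum_add_distrib, Finset.sum_add_distrib, e1, e2, e3]
    ring
  have hsum := Finset.sum_le_sum (s := Finset.univ) fun a _ => hle a
  rw [hrot w, Finset.sum_add_distrib, ← Finset.mul_sum, hrot D, Finset.sum_const, Finset.card_univ,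
    hn] at hsum
  have hwsum : ∑ a, w a = n + 2 := by
    rw [sum_inv_minimalPeriod, h.numCycles_le hn]
    push_cast
    ring
  have hDsum : ∑ a, D a = {a | Detachable n σ τ a}.ncard := by
    simp only [D]
    rw [Finset.sum_boole, ← Set.ncard_coe_finset]
    simp
  rw [hwsum, hDsum, nsmul_eq_mul] at hsum
  -- The sum reads `4 (n + 2) ≤ 4 n · 77/78 + 16 N` with `N` detachable flags, whence `312 = 4 ·
  -- 78`.
  have : (n : ℚ) ≤ 312 * ({a | Detachable n σ τ a}.ncard : ℚ) := by
    push_cast at hsum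
    linarith
  exact_mod_cast this

end Count

/-! ### Moving a crossing onto a marked face -/

section Transfer

variable {F : Type*}

/-- The face of `b` has degree `j` and does not lie on both sides of the edge of `b`. -/
def HasSimpleFace (σ τ : Perm F) (j : ℕ) (b : F) : Prop :=
  Function.minimalPeriod (σ * τ) b = j ∧ ∀ i, (σ * τ)^[i] b ≠ τ b

theorem minimalPeriod_eq_of_iterate_eq {f g : F → F} {x : F} (h : ∀ i, f^[i] x = g^[i] x) :
    Function.minimalPeriod f x = Function.minimalPeriod g x := by
  rw [Function.minimalPeriod_eq_minimalPeriod_iff]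
  intro i
  rw [Function.IsPeriodicPt, Function.IsPeriodicPt, Function.IsFixedPt, Function.IsFixedPt, h]

theorem HasSimpleFace.congr {σ τ τ' : Perm F} {S : Set F} (hS : ∀ x, σ x ∈ S ↔ x ∈ S)
    (ho : ∀ z, z ∉ S → τ z ∉ S → τ' z = τ z) {j : ℕ} {b : F} (h : HasSimpleFace σ τ j b)
    (hb : ∀ i, (σ * τ)^[i] b ∉ S) : HasSimpleFace σ τ' j b := by
  have hτ : ∀ i, τ' ((σ * τ)^[i] b) = τ ((σ * τ)^[i] b) := by
    intro i
    refine ho _ (hb i) ?_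
    have := hb (i + 1)
    rwa [Function.iterate_succ_apply', Perm.mul_apply, hS] at this
  have hit : ∀ i, (σ * τ')^[i] b = (σ * τ)^[i] b := by
    intro i
    induction i with
    | zero => rfl
    | succ i ih =>
      rw [Function.iterate_succ_apply', Function.iterate_succ_apply', ih, Perm.mul_apply,
        Perm.mul_apply, hτ]
  refine ⟨by rw [minimalPeriod_eq_of_iterate_eq hit]; exact h.1, fun i => ?_⟩
  have := hτ 0
  rw [Function.iterate_zero, id] at this
  rw [hit, this]
  exact h.2 i

theorem mem_vert_comm {σ : Perm F} (hσ : IsQuartic σ) {a x : F} : x ∈ vert σ a ↔ a ∈ vert σ x := by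
  have key : ∀ {a x : F}, x ∈ vert σ a → a ∈ vert σ x := by
    rintro a x (rfl | rfl | rfl | rfl)
    all_goals simp [mem_vert, (hσ a).2]
  exact ⟨key, key⟩

variable [DecidableEq F]

theorem Detached.isCurve_kink [Finite F] {n : ℕ} {σ τ' : Perm F} {a b : F} (hσ : IsQuartic σ)
    (h : Detached n σ τ' a) (hb : b ∉ vert σ a) : IsCurve n σ (kink σ τ' a b) := by
  have hj := joinedOn_kink hσ h.pairing h.floats (A := (vert σ a)ᶜ) disjoint_compl_left hb h.joined
    (fun x hx hx' => hx ((h.floats.mem_vert_iff h.pairing).1 hx'))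
  rw [Set.compl_union_self] at hj
  have h1 := numCycles_le_kink hσ h.pairing h.floats hb
  have h2 := h.faces
  exact ⟨hσ, h.pairing.kink σ a b, hj, by omega⟩

theorem hasSimpleFace_kink_monogon {σ τ' : Perm F} {a b : F} (hσ : IsQuartic σ)
    (hτ : IsPairing τ') (hf : Floats σ τ' a) (hb : b ∉ vert σ a) :
    HasSimpleFace σ (kink σ τ' a b) 1 (σ (σ a)) := by
  obtain ⟨k0, k1, k2, k3, k4, k5, k6⟩ := kink_values hσ hτ hf hb
  have hfix : (σ * kink σ τ' a b) (σ (σ a)) = σ (σ a) := by rw [Perm.mul_apply, k2]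
  refine ⟨Function.minimalPeriod_eq_one_iff_isFixedPt.2 hfix, fun i => ?_⟩
  rw [Function.iterate_fixed hfix, k2]
  exact hσ.turns.ne _

/-- The new face leaves `a`, follows the old face from `σ (τ' b)` to `b` and returns to `a` in one
extra step. Simplicity keeps the old face off the other side of the edge of `b`, where the kink also
interferes. -/
theorem hasSimpleFace_kink [Finite F] {σ τ' : Perm F} {a b : F} (hσ : IsQuartic σ)
    (hτ : IsPairing τ') (hf : Floats σ τ' a) (hb : b ∉ vert σ a) {j : ℕ}
    (h : HasSimpleFace σ τ' j b) : HasSimpleFace σ (kink σ τ' a b) (j + 1) a := by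
  obtain ⟨k0, k1, k2, k3, k4, k5, k6⟩ := kink_values hσ hτ hf hb
  have hV : ∀ i, (σ * τ')^[i] b ∉ vert σ a := by
    intro i
    induction i with
    | zero => exact hb
    | succ i ih =>
      rw [Function.iterate_succ_apply', Perm.mul_apply, hσ.apply_mem_vert,
        hf.mem_vert_iff hτ]
      exact ih
  have hj : 0 < j := by rw [← h.1]; exact minimalPeriod_pos _ _
  have hper : (σ * τ')^[j] b = b := by
    rw [← h.1]; exact Function.iterate_minimalPeriod
  have hit : ∀ i, i < j → (σ * kink σ τ' a b)^[i + 1] a = (σ * τ')^[i + 1] b := by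
    intro i
    induction i with
    | zero => intro _; simp [k0]
    | succ i ih =>
      intro hi
      rw [Function.iterate_succ_apply', ih (by omega), Function.iterate_succ_apply' _ (i + 1) b,
        Perm.mul_apply, Perm.mul_apply, k6 _ (hV _) ?_ (h.2 _)]
      exact fun e => Function.not_isPeriodicPt_of_pos_of_lt_minimalPeriod (by omega)
        (by rw [h.1]; exact hi) e
  have hlast : (σ * kink σ τ' a b)^[j + 1] a = a := by
    obtain ⟨i, rfl⟩ := Nat.exists_eq_succ_of_ne_zero hj.ne'
    rw [Function.iterate_succ_apply', hit i (by omega), hper, Perm.mul_apply, k5, (hσ a).2]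
  have hmem : ∀ i, (σ * kink σ τ' a b)^[i] a = a ∨
      ∃ m, (σ * kink σ τ' a b)^[i] a = (σ * τ')^[m] b := by
    intro i
    have hp : Function.IsPeriodicPt (σ * kink σ τ' a b) (j + 1) a := hlast
    rw [← hp.iterate_mod_apply i]
    rcases Nat.eq_zero_or_pos (i % (j + 1)) with e | e
    · left; rw [e]; rfl
    · right
      have hlt : i % (j + 1) < j + 1 := Nat.mod_lt i (Nat.succ_pos j)
      obtain ⟨r, hr⟩ := Nat.exists_eq_succ_of_ne_zero e.ne'
      rw [hr]
      exact ⟨r + 1, hit r (by omega)⟩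
  constructor
  · refine le_antisymm (Function.IsPeriodicPt.minimalPeriod_le (Nat.succ_pos j) hlast) ?_
    by_contra hlt
    have hpos := minimalPeriod_pos (σ * kink σ τ' a b) a
    have hp := Function.iterate_minimalPeriod (f := σ * kink σ τ' a b) (x := a)
    obtain ⟨i, hi⟩ := Nat.exists_eq_succ_of_ne_zero hpos.ne'
    rw [hi] at hp
    rw [Nat.succ_eq_add_one, hit i (by omega)] at hp
    exact hV (i + 1) (by rw [hp]; simp [mem_vert])
  · intro i
    rw [k0]
    rcases hmem i with e | ⟨m, e⟩
    · rw [e]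
      rintro rfl
      exact hb ((hf.mem_vert_iff hτ).1 (by simp [mem_vert]))
    · rw [e]; exact h.2 m

/-- `b` is the partner of `σ³ a` in the kinked curve and `τ b` that of `a`; all other edges are
unchanged or prescribed. -/
theorem kink_injective {σ τ₁ τ₂ : Perm F} {a b₁ b₂ : F} (hσ : IsQuartic σ)
    (h1 : IsPairing τ₁) (h2 : IsPairing τ₂) (f1 : Floats σ τ₁ a) (f2 : Floats σ τ₂ a)
    (hb1 : b₁ ∉ vert σ a) (hb2 : b₂ ∉ vert σ a)
    (h : kink σ τ₁ a b₁ = kink σ τ₂ a b₂) : b₁ = b₂ ∧ τ₁ = τ₂ := by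
  obtain ⟨k0, -, -, -, k4, -, k6⟩ := kink_values hσ h1 f1 hb1
  obtain ⟨l0, -, -, -, l4, -, l6⟩ := kink_values hσ h2 f2 hb2
  have hb : b₁ = b₂ := by rw [← k4, ← l4, h]
  subst hb
  refine ⟨rfl, ?_⟩
  have ha : τ₁ b₁ = τ₂ b₁ := by rw [← k0, ← l0, h]
  ext z
  by_cases hz : z ∈ vert σ a
  · obtain ⟨g0, g1, g2, g3⟩ := f1.apply h1
    obtain ⟨g4, g5, g6, g7⟩ := f2.apply h2
    rcases hz with rfl | rfl | rfl | rfl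
    · rw [g0, g4]
    · rw [g1, g5]
    · rw [g2, g6]
    · rw [g3, g7]
  by_cases e1 : z = b₁
  · rw [e1, ha]
  by_cases e2 : z = τ₁ b₁
  · rw [e2, (h1 _).2, ha, (h2 _).2]
  rw [← k6 z hz e1 e2, ← l6 z hz e1 (ha ▸ e2), h]

/-- Each `x` excludes the four flags of its own crossing and the at most four flags `a` for which `τ
(σ (σ a))` lies there. -/
theorem card_near_le [Fintype F] {σ τ : Perm F} (hσ : IsQuartic σ) (hτ : IsPairing τ)
    (X : Finset F) :
    {a | ∃ x ∈ X, x ∈ vert σ a ∪ vert σ (τ (σ (σ a)))}.ncard ≤ 8 * X.card := by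
  let V : F → Finset F := fun x => {x, σ x, σ (σ x), σ (σ (σ x))}
  have hV : ∀ x y, y ∈ V x ↔ y ∈ vert σ x := fun x y => by simp [V, mem_vert]
  have hVc : ∀ x, (V x).card ≤ 4 := fun x => Finset.card_le_four
  let B : Finset F := X.biUnion fun x => V x ∪ (V x).image fun y => σ (σ (τ y))
  have hsub : {a | ∃ x ∈ X, x ∈ vert σ a ∪ vert σ (τ (σ (σ a)))} ⊆ B := by
    rintro a ⟨x, hx, h⟩
    simp only [B, Finset.coe_biUnion, Set.mem_iUnion]
    refine ⟨x, hx, ?_⟩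
    rw [Finset.mem_coe, Finset.mem_union]
    rcases h with h | h
    · exact Or.inl ((hV _ _).2 ((mem_vert_comm hσ).1 h))
    · exact Or.inr (Finset.mem_image.2 ⟨_, (hV _ _).2 ((mem_vert_comm hσ).1 h),
        by rw [(hτ _).2, (hσ a).2]⟩)
  refine (Set.ncard_le_ncard hsub (Finset.finite_toSet B)).trans ?_
  rw [Set.ncard_coe_finset]
  refine (Finset.card_biUnion_le_card_mul _ _ 8 fun x _ => ?_).trans (by rw [mul_comm])
  exact (Finset.card_union_le _ _).trans
    (Nat.add_le_add (hVc x) (Finset.card_image_le.trans (hVc x)))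

/-- Detaching a vertex and attaching it elsewhere compares the numbers of two kinds of flags. -/
theorem card_le_of_transfer [Fintype F] {n m : ℕ} {σ : Perm F} (hn : Fintype.card F = 4 * n)
    (hn4 : 4 ≤ n) (hnm : 4992 * m ≤ n) {R R' : Perm F → F → Prop} (X : Perm F → F → Finset F)
    (hX : ∀ τ b, b ∈ X τ b) (hXm : ∀ τ b, IsCurve n σ τ → R τ b → (X τ b).card ≤ m) (ρ : Perm F)
    (hR : ∀ τ b a τ', IsCurve n σ τ → R τ b → Detached n σ τ' a → b ∉ vert σ a →
      (∀ x ∈ X τ b, x ∉ vert σ a ∪ vert σ (τ (σ (σ a)))) →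
      (∀ z, z ∉ vert σ a ∪ vert σ (τ (σ (σ a))) → τ z ∉ vert σ a ∪ vert σ (τ (σ (σ a))) →
        τ' z = τ z) → R' (kink σ τ' a b) (ρ a)) :
    {p : Perm F × F | IsCurve n σ p.1 ∧ R p.1 p.2}.ncard ≤
      32448 * {p : Perm F × F | IsCurve n σ p.1 ∧ R' p.1 p.2}.ncard := by
  classical
  let A : Finset (Perm F × F) := Finset.univ.filter fun p => IsCurve n σ p.1 ∧ R p.1 p.2
  let B : Finset (Perm F × F) := Finset.univ.filter fun p => IsCurve n σ p.1 ∧ R' p.1 p.2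
  let far : Perm F × F → F → Prop := fun p a =>
    ∀ x ∈ X p.1 p.2, x ∉ vert σ a ∪ vert σ (p.1 (σ (σ a)))
  let G : Perm F × F → Finset F := fun p => Finset.univ.filter fun a =>
    Detachable n σ p.1 a ∧ far p a
  have hA : {p : Perm F × F | IsCurve n σ p.1 ∧ R p.1 p.2}.ncard = A.card := by
    rw [← Set.ncard_coe_finset]; simp [A]
  have hB : {p : Perm F × F | IsCurve n σ p.1 ∧ R' p.1 p.2}.ncard = B.card := by
    rw [← Set.ncard_coe_finset]; simp [B]
  rw [hA, hB]
  -- Of the at least `n / 312` detachable flags, at most `8 m ≤ n / 624` are near `X`, since `4992 =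
  -- 8 · 624`.
  have hG : ∀ p ∈ A, n ≤ 624 * (G p).card := by
    intro p hp
    obtain ⟨hc, hr⟩ := (Finset.mem_filter.1 hp).2
    have h1 := hc.le_card_detachable hn hn4
    have h2 := card_near_le hc.quartic hc.pairing (X p.1 p.2)
    have h3 := hXm p.1 p.2 hc hr
    have h4 : {a | Detachable n σ p.1 a} ⊆
        (G p : Set F) ∪ {a | ∃ x ∈ X p.1 p.2, x ∈ vert σ a ∪ vert σ (p.1 (σ (σ a)))} := by
      intro a ha
      by_cases hf : far p a
      · left; simp only [G, Finset.coe_filter, Finset.mem_univ, true_and]; exact ⟨ha, hf⟩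
      · right
        simp only [far, not_forall, not_not] at hf
        obtain ⟨x, hx, hx'⟩ := hf
        exact ⟨x, hx, hx'⟩
    have h5 := (Set.ncard_le_ncard h4 (Set.toFinite _)).trans (Set.ncard_union_le _ _)
    rw [Set.ncard_coe_finset] at h5
    omega
  have hdet : ∀ p : Perm F × F, ∀ a, Detachable n σ p.1 a → ∃ τ' : Perm F, ∃ c : F × Fin 13,
      Detached n σ τ' a ∧ Code σ p.1 τ' a c.1 c.2 ∧
      ∀ z, z ∉ vert σ a ∪ vert σ (p.1 (σ (σ a))) → p.1 z ∉ vert σ a ∪ vert σ (p.1 (σ (σ a))) →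
        τ' z = p.1 z := by
    rintro p a ⟨τ', m, i, h1, h2, h3, h4⟩
    exact ⟨τ', (m, ⟨i, h3⟩), h1, h2, h4⟩
  choose! T c hT using hdet
  have hmem : ∀ q ∈ A.sigma G, q.1.2 ∉ vert σ q.2 ∧ IsCurve n σ q.1.1 ∧ R q.1.1 q.1.2 ∧
      Detachable n σ q.1.1 q.2 ∧ far q.1 q.2 := by
    rintro ⟨p, a⟩ hq
    obtain ⟨h1, h2⟩ := Finset.mem_sigma.1 hq
    obtain ⟨hc, hr⟩ := (Finset.mem_filter.1 h1).2
    obtain ⟨hd, hf⟩ := (Finset.mem_filter.1 h2).2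
    exact ⟨fun e => hf _ (hX _ _) (Or.inl e), hc, hr, hd, hf⟩
  have hcard : (A.sigma G).card ≤ (B ×ˢ (Finset.univ : Finset (F × Fin 13))).card := by
    -- The image determines `a` through `ρ`, then `b` and the detached pairing through the kink,
    -- then the original pairing through the code.
    refine Finset.card_le_card_of_injOn
      (fun q => ((kink σ (T q.1 q.2) q.2 q.1.2, ρ q.2), c q.1 q.2)) ?_ ?_
    · intro q hq
      obtain ⟨h1, h2, h3, h4, h5⟩ := hmem q hq
      obtain ⟨t1, t2, t3⟩ := hT q.1 q.2 h4
      simp only [Finset.coe_product, Set.mem_prod, Finset.mem_coe, Finset.mem_univ, and_true, B,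
        Finset.mem_filter, true_and]
      exact ⟨t1.isCurve_kink h2.quartic h1, hR _ _ _ _ h2 h3 t1 h1 h5 t3⟩
    · rintro ⟨⟨τ₁, b₁⟩, a₁⟩ hq ⟨⟨τ₂, b₂⟩, a₂⟩ hq' he
      obtain ⟨h1, h2, h3, h4, h5⟩ := hmem _ hq
      obtain ⟨t1, t2, t3⟩ := hT _ _ h4
      obtain ⟨h1', h2', h3', h4', h5'⟩ := hmem _ hq'
      obtain ⟨t1', t2', t3'⟩ := hT _ _ h4'
      simp only [Prod.mk.injEq] at he
      obtain ⟨⟨e1, e2⟩, e3⟩ := he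
      have e4 : a₁ = a₂ := ρ.injective e2
      subst e4
      obtain ⟨e5, e6⟩ := kink_injective h2.quartic t1.pairing t1'.pairing t1.floats t1'.floats
        h1 h1' e1
      simp only at e5 e6 t2 t2' h2 h2'
      rw [e3, e6] at t2
      have e7 := t2.unique h2.pairing h2'.pairing t2'
      subst e5 e7
      rfl
  rw [Finset.card_sigma, Finset.card_product, Finset.card_univ, Fintype.card_prod, hn,
    Fintype.card_fin] at hcard
  have hsum : A.card * n ≤ 624 * ∑ p ∈ A, (G p).card := by
    rw [Finset.mul_sum, ← smul_eq_mul, ← Finset.sum_const]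
    exact Finset.sum_le_sum hG
  -- `32448 = 624 · 4 · 13`.
  have hfin : A.card * n ≤ 32448 * B.card * n := by
    calc A.card * n ≤ 624 * (B.card * (4 * n * 13)) := hsum.trans (Nat.mul_le_mul_left _ hcard)
      _ = 32448 * B.card * n := by ring
  exact Nat.le_of_mul_le_mul_right hfin (by omega)

/-- Induction on the degree. At the start only the monogon of the kink matters, and it lies at `σ (σ
a)`, hence `ρ = σ * σ`. Afterwards `X` is the whole marked face, and the enlarged face is marked at
`a`. -/
theorem card_isCurve_le [Fintype F] {n : ℕ} {σ : Perm F} (hn : Fintype.card F = 4 * n) (k : ℕ)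
    (hnk : 4992 * (k + 1) ≤ n) :
    {τ : Perm F | IsCurve n σ τ}.ncard * (4 * n) ≤
      32448 ^ (k + 1) *
        {p : Perm F × F | IsCurve n σ p.1 ∧ HasSimpleFace σ p.1 (k + 1) p.2}.ncard := by
  classical
  induction k with
  | zero =>
    have h := card_le_of_transfer (m := 1) (σ := σ) (R := fun _ _ => True)
      (R' := fun τ r => HasSimpleFace σ τ 1 r) hn (by omega) (by omega) (fun _ b => {b})
      (fun _ b => Finset.mem_singleton_self b) (fun _ _ _ _ => by simp) (σ * σ)
      (fun τ b a τ' hc _ hd hb _ _ => hasSimpleFace_kink_monogon hc.quartic hd.pairing hd.floats hb)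
    have e : {p : Perm F × F | IsCurve n σ p.1 ∧ True} =
        {τ : Perm F | IsCurve n σ τ} ×ˢ (Set.univ : Set F) := by
      ext p; simp
    rw [e, Set.ncard_prod, Set.ncard_univ, Nat.card_eq_fintype_card, hn] at h
    simpa using h
  | succ k ih =>
    refine (ih (by omega)).trans ?_
    have h := card_le_of_transfer (m := k + 1) (σ := σ)
      (R := fun τ b => HasSimpleFace σ τ (k + 1) b)
      (R' := fun τ r => HasSimpleFace σ τ (k + 1 + 1) r) hn (by omega) (by omega)
      (fun τ b => Finset.univ.filter fun y => SameCycle (σ * τ) b y)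
      (fun τ b => Finset.mem_filter.2 ⟨Finset.mem_univ b, SameCycle.refl _ _⟩)
      (fun τ b _ hb => ?_) 1
      (fun τ b a τ' hc hb hd hba hX ho => ?_)
    · rw [pow_succ 32448 (k + 1), mul_assoc]
      exact Nat.mul_le_mul_left _ h
    · rw [← hb.1, ← ncard_sameCycle, ← Set.ncard_coe_finset]
      simp
    · refine hasSimpleFace_kink hc.quartic hd.pairing hd.floats hba
        (hb.congr (S := vert σ a ∪ vert σ (τ (σ (σ a)))) (fun x => ?_) ho (fun i => hX _ ?_))
      · rw [Set.mem_union, Set.mem_union, hc.quartic.apply_mem_vert, hc.quartic.apply_mem_vert]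
      · simp only [Finset.mem_filter, Finset.mem_univ, true_and]
        exact ⟨i, by rw [zpow_natCast, ← Equiv.Perm.iterate_eq_pow]⟩

end Transfer

/-! ### Cycle types in terms of minimal periods -/

section Partition

variable {F : Type*} [Fintype F] [DecidableEq F]

theorem card_support_cycleOf {φ : Perm F} {x : F} (hx : x ∈ φ.support) :
    (φ.cycleOf x).support.card = Function.minimalPeriod φ x := by
  rw [← ncard_sameCycle, ← Set.ncard_coe_finset]
  congr 1
  ext y
  rw [Finset.mem_coe, mem_support_cycleOf_iff]
  exact ⟨fun h => h.1, fun h => ⟨h, hx⟩⟩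

/-- A cycle of length `k` contains `k` flags. Fixed points are treated apart because `cycleType`
omits them. -/
theorem mul_count_partition (φ : Perm F) (k : ℕ) :
    k * φ.partition.parts.count k =
      (Finset.univ.filter fun x => Function.minimalPeriod φ x = k).card := by
  have h1 : k * φ.cycleType.count k =
      (φ.support.filter fun x => Function.minimalPeriod φ x = k).card := by
    rw [Finset.card_eq_sum_card_fiberwise (f := φ.cycleOf) (t := φ.cycleFactorsFinset)]
    · rw [cycleType_def, Multiset.count_map, ← Finset.filter_val, Finset.card_val,
        Finset.card_filter, Finset.mul_sum]
      refine Finset.sum_congr rfl fun c hc => ?_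
      have hsub : ∀ x, x ∈ c.support → x ∈ φ.support := fun x hx =>
        mem_cycleFactorsFinset_support_le hc hx
      have hiff : ∀ x, φ.cycleOf x = c ↔ x ∈ c.support := fun x => by
        rw [eq_comm]; exact eq_cycleOf_of_mem_cycleFactorsFinset_iff φ c hc x
      by_cases hk : k = c.support.card
      · simp only [Function.comp, hk, if_true, mul_one]
        congr 1
        ext x
        simp only [Finset.mem_filter, hiff]
        refine ⟨fun hx => ⟨⟨hsub x hx, ?_⟩, hx⟩, fun hx => hx.2⟩
        rw [← card_support_cycleOf (hsub x hx), (hiff x).2 hx]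
      · simp only [Function.comp, hk, if_false, mul_zero]
        rw [eq_comm, Finset.card_eq_zero, Finset.filter_eq_empty_iff]
        intro x hx hxc
        obtain ⟨hx1, hx2⟩ := Finset.mem_filter.1 hx
        rw [← card_support_cycleOf hx1, hxc] at hx2
        exact hk hx2.symm
    · intro x hx
      exact cycleOf_mem_cycleFactorsFinset_iff.2 (Finset.mem_filter.1 hx).1
  have h2 : k * (Multiset.replicate (Fintype.card F - φ.support.card) 1).count k =
      (φ.supportᶜ.filter fun x => Function.minimalPeriod φ x = k).card := by
    have hfix : ∀ x ∈ φ.supportᶜ, Function.minimalPeriod φ x = 1 := by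
      intro x hx
      rw [Finset.mem_compl, notMem_support] at hx
      exact Function.minimalPeriod_eq_one_iff_isFixedPt.2 hx
    rw [Multiset.count_replicate]
    by_cases hk : 1 = k
    · subst hk
      rw [if_pos rfl, one_mul, Finset.filter_true_of_mem hfix, Finset.card_compl]
    · rw [if_neg hk, mul_zero, eq_comm, Finset.card_eq_zero, Finset.filter_eq_empty_iff]
      intro x hx
      rw [hfix x hx]
      exact hk
  rw [parts_partition, Multiset.count_add, mul_add, h1, h2, ← Finset.card_union_of_disjoint,
    ← Finset.filter_union, Finset.union_compl]
  exact Finset.disjoint_filter_filter disjoint_compl_right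

theorem minimalPeriod_mem_partition (φ : Perm F) (x : F) :
    Function.minimalPeriod φ x ∈ φ.partition.parts := by
  rw [← Multiset.count_pos]
  have h := mul_count_partition φ (Function.minimalPeriod φ x)
  have hpos : 0 < (Finset.univ.filter fun y =>
      Function.minimalPeriod φ y = Function.minimalPeriod φ x).card :=
    Finset.card_pos.2 ⟨x, by simp⟩
  rw [← h] at hpos
  exact Nat.pos_of_mul_pos_left hpos

theorem card_partition (φ : Perm F) : Multiset.card φ.partition.parts = numCycles φ := by
  have h := sum_inv_minimalPeriod φ
  rw [← Finset.sum_fiberwise_of_maps_to (g := fun x => Function.minimalPeriod φ x)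
    (t := φ.partition.parts.toFinset)
    (fun x _ => Multiset.mem_toFinset.2 (minimalPeriod_mem_partition φ x))] at h
  have h2 : ∀ k ∈ φ.partition.parts.toFinset,
      ∑ x ∈ Finset.univ.filter (fun x => Function.minimalPeriod φ x = k),
        (1 : ℚ) / Function.minimalPeriod φ x = φ.partition.parts.count k := by
    intro k hk
    have hk0 : 0 < k := φ.partition.parts_pos (Multiset.mem_toFinset.1 hk)
    rw [Finset.sum_congr rfl (g := fun _ => (1 : ℚ) / k)
      (fun x hx => by rw [(Finset.mem_filter.1 hx).2]), Finset.sum_const, ← mul_count_partition,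
      nsmul_eq_mul]
    push_cast
    field_simp
  rw [Finset.sum_congr rfl h2, ← Nat.cast_sum, Multiset.toFinset_sum_count_eq] at h
  exact_mod_cast h

theorem cycleType_eq_replicate_iff {φ : Perm F} {m d : ℕ} (hd : 2 ≤ d)
    (hF : Fintype.card F = d * m) :
    φ.cycleType = Multiset.replicate m d ↔ ∀ x, Function.minimalPeriod φ x = d := by
  constructor
  · intro h x
    have hs := sum_cycleType φ
    rw [h, Multiset.sum_replicate, nsmul_eq_mul, Nat.cast_id] at hs
    have hx := minimalPeriod_mem_partition φ x
    rw [parts_partition, ← hs, hF, mul_comm, Nat.sub_self, h] at hx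
    simp only [Multiset.replicate_zero, add_zero] at hx
    exact Multiset.eq_of_mem_replicate hx
  · intro h
    have hall : ∀ k ∈ φ.partition.parts, k = d := by
      intro k hk
      by_contra hne
      have h1 := mul_count_partition φ k
      have h2 : (Finset.univ.filter fun x => Function.minimalPeriod φ x = k) = ∅ := by
        rw [Finset.filter_eq_empty_iff]
        intro x _
        rw [h x]
        exact Ne.symm hne
      rw [h2, Finset.card_empty] at h1
      have := φ.partition.parts_pos hk
      have := Multiset.count_pos.2 hk
      have := Nat.mul_pos ‹0 < k› this
      omega
    have h3 := Multiset.eq_replicate_card.2 hall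
    have h4 := φ.partition.parts_sum
    rw [h3, Multiset.sum_replicate, nsmul_eq_mul, Nat.cast_id] at h4
    have h5 := Nat.eq_of_mul_eq_mul_right (by omega) (h4.trans (hF.trans (mul_comm d m)))
    rw [← filter_parts_partition_eq_cycleType, h3, h5]
    exact Multiset.filter_eq_self.2 fun a ha => by rw [Multiset.eq_of_mem_replicate ha]; exact hd

theorem isQuartic_iff {F : Type*} {σ : Perm F} :
    IsQuartic σ ↔ ∀ x, Function.minimalPeriod σ x = 4 := by
  constructor
  · intro h x
    have h4 : Function.minimalPeriod σ x ∣ 4 :=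
      Function.IsPeriodicPt.minimalPeriod_dvd (show Function.IsPeriodicPt σ 4 x from (h x).2)
    have h2 : ¬ Function.minimalPeriod σ x ∣ 2 := fun e =>
      (h x).1 (show Function.IsPeriodicPt σ 2 x from
        Function.isPeriodicPt_iff_minimalPeriod_dvd.2 e)
    have hle := Nat.le_of_dvd (by norm_num) h4
    interval_cases Function.minimalPeriod σ x <;> revert h4 h2 <;> decide
  · intro h x
    constructor
    · intro e
      exact Function.not_isPeriodicPt_of_pos_of_lt_minimalPeriod (n := 2) (by norm_num)
        (by rw [h x]; norm_num) e
    · have := Function.iterate_minimalPeriod (f := σ) (x := x)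
      rwa [h x] at this

theorem isPairing_iff {F : Type*} {τ : Perm F} :
    IsPairing τ ↔ ∀ x, Function.minimalPeriod τ x = 2 := by
  constructor
  · intro h x
    have h2 : Function.minimalPeriod τ x ∣ 2 :=
      Function.IsPeriodicPt.minimalPeriod_dvd (show Function.IsPeriodicPt τ 2 x from (h x).2)
    have h1 : Function.minimalPeriod τ x ≠ 1 := fun e =>
      (h x).1 (Function.minimalPeriod_eq_one_iff_isFixedPt.1 e)
    have hle := Nat.le_of_dvd (by norm_num) h2
    interval_cases Function.minimalPeriod τ x <;> revert h1 h2 <;> decide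
  · intro h x
    constructor
    · intro e
      have := h x
      rw [Function.minimalPeriod_eq_one_iff_isFixedPt.2 e] at this
      omega
    · have := Function.iterate_minimalPeriod (f := τ) (x := x)
      rwa [h x] at this

end Partition

/-! ### Labelled curves and `IsCurve` -/

section Labelled

theorem _root_.LabelledCurve.isCurve {n : ℕ} (C : LabelledCurve n) : IsCurve n C.σ C.τ := by
  have hσ : IsQuartic C.σ :=
    isQuartic_iff.2 ((cycleType_eq_replicate_iff (by norm_num) (Fintype.card_fin _)).1 C.vertices)
  have hτ : IsPairing C.τ :=
    isPairing_iff.2 ((cycleType_eq_replicate_iff (by norm_num)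
      (by rw [Fintype.card_fin]; ring)).1 C.edges)
  have : Nonempty (Fin (4 * n)) := ⟨C.root⟩
  refine ⟨hσ, hτ, (joinedOn_univ_iff_numCycles hσ.turns.isPairing hτ).2 ?_, ?_⟩
  · rw [← card_partition, ← pow_two]
    exact C.curve
  · rw [← card_partition, C.planar]

/-- A plane curve with a root flag is a labelled curve. -/
def IsCurve.toLabelledCurve {n : ℕ} {σ τ : Perm (Fin (4 * n))} (h : IsCurve n σ τ)
    (a : Fin (4 * n)) : LabelledCurve n where
  σ := σ
  τ := τ
  root := a
  vertices := (cycleType_eq_replicate_iff (by norm_num) (Fintype.card_fin _)).2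
    (isQuartic_iff.1 h.quartic)
  edges := (cycleType_eq_replicate_iff (by norm_num) (by rw [Fintype.card_fin]; ring)).2
    (isPairing_iff.1 h.pairing)
  connected := by
    constructor
    intro x y
    let f : Fin (4 * n) → Prop := fun z => ∃ g : Subgroup.closure {σ, τ}, g • x = z
    have hinv : ∀ g : Subgroup.closure {σ, τ}, ∀ z, f (g • z) ↔ f z := by
      intro g z
      constructor
      · rintro ⟨k, hk⟩
        exact ⟨g⁻¹ * k, by rw [mul_smul, hk, inv_smul_smul]⟩
      · rintro ⟨k, rfl⟩
        exact ⟨g * k, mul_smul _ _ _⟩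
    have hσ : σ ∈ Subgroup.closure {σ, τ} := Subgroup.subset_closure (by simp)
    have hτ : τ ∈ Subgroup.closure {σ, τ} := Subgroup.subset_closure (by simp)
    exact h.joined f (fun z _ => hinv ⟨σ * σ, mul_mem hσ hσ⟩ z) (fun z _ => hinv ⟨τ, hτ⟩ z)
      x trivial y trivial ⟨1, one_smul _ _⟩
  planar := by
    have : Nonempty (Fin (4 * n)) := ⟨a⟩
    rw [card_partition]
    exact h.numCycles_le (Fintype.card_fin _)
  curve := by
    have : Nonempty (Fin (4 * n)) := ⟨a⟩
    rw [card_partition, pow_two]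
    exact (joinedOn_univ_iff_numCycles h.quartic.turns.isPairing h.pairing).1 h.joined

end Labelled

/-! ### Relabelling the flags -/

section Transport

variable {F F' : Type*} [Finite F']

theorem IsCurve.map {n : ℕ} {σ τ : Perm F} (h : IsCurve n σ τ) (e : F ≃ F') :
    IsCurve n (e.permCongr σ) (e.permCongr τ) where
  quartic x := by
    have := h.quartic (e.symm x)
    simp only [permCongr_apply, symm_apply_apply]
    refine ⟨fun hx => this.1 ?_, by rw [this.2, apply_symm_apply]⟩
    rw [← e.symm_apply_apply (σ (σ (e.symm x))), hx]
  pairing x := by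
    have := h.pairing (e.symm x)
    simp only [permCongr_apply, symm_apply_apply]
    refine ⟨fun hx => this.1 ?_, by rw [this.2, apply_symm_apply]⟩
    rw [← e.symm_apply_apply (τ (e.symm x)), hx]
  joined := by
    intro f hs hτ x _ y _ hx
    have := h.joined (fun z => f (e z)) (fun z _ => ?_) (fun z _ => ?_) (e.symm x) trivial
      (e.symm y) trivial (by simpa using hx)
    · simpa using this
    · simpa using hs (e z) trivial
    · simpa using hτ (e z) trivial
  faces := by
    refine h.faces.trans (card_le_numCycles
      (fun x => Quotient.mk (SameCycle.setoid (σ * τ)) (e.symm x)) (fun x => ?_) fun c => ?_)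
    · simp only [Perm.mul_apply, permCongr_apply, symm_apply_apply]
      exact mk_apply (σ * τ) (e.symm x)
    · induction c using Quotient.inductionOn with
      | _ z => exact ⟨e z, by simp⟩

end Transport

/-! ### Existence of curves with any positive number of crossings -/

section Example

variable (n : ℕ)

/-- The vertices of a circle with `n` kinks. -/
def circleVertices : Perm (ZMod n × Fin 4) where
  toFun x := (x.1, x.2 + 1)
  invFun x := (x.1, x.2 - 1)
  left_inv x := by simp
  right_inv x := by simp

/-- The edges of a circle with `n` kinks. -/
def circleEdgesFun : ZMod n × Fin 4 → ZMod n × Fin 4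
  | (i, 0) => (i - 1, 3)
  | (i, 1) => (i, 2)
  | (i, 2) => (i, 1)
  | (i, 3) => (i + 1, 0)

theorem circleEdgesFun_involutive : Function.Involutive (circleEdgesFun n) := by
  rintro ⟨i, r⟩
  fin_cases r <;> simp [circleEdgesFun]

/-- The edges of a circle with `n` kinks. -/
def circleEdges : Perm (ZMod n × Fin 4) := (circleEdgesFun_involutive n).toPerm

/-- The face of a flag of a circle with `n` kinks. -/
def circleFace : ZMod n × Fin 4 → ZMod n ⊕ Bool
  | (_, 0) => Sum.inr false
  | (_, 1) => Sum.inr true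
  | (i, 2) => Sum.inl i
  | (_, 3) => Sum.inr true

theorem isCurve_circle [NeZero n] : IsCurve n (circleVertices n) (circleEdges n) where
  quartic := by
    rintro ⟨i, r⟩
    fin_cases r <;> simp [circleVertices]
  pairing := by
    rintro ⟨i, r⟩
    refine ⟨?_, circleEdgesFun_involutive n _⟩
    fin_cases r <;> simp [circleEdges, circleEdgesFun]
  joined := by
    intro f hs hτ
    have h02 : ∀ i, f (i, 2) ↔ f (i, 0) := fun i => hs (i, 0) trivial
    have h13 : ∀ i, f (i, 3) ↔ f (i, 1) := fun i => hs (i, 1) trivial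
    have h12 : ∀ i, f (i, 2) ↔ f (i, 1) := fun i => hτ (i, 1) trivial
    have h30 : ∀ i, f (i + 1, 0) ↔ f (i, 3) := fun i => hτ (i, 3) trivial
    have hnat : ∀ m : ℕ, f ((m : ZMod n), 0) ↔ f (0, 0) := by
      intro m
      induction m with
      | zero => simp
      | succ m ih => rw [Nat.cast_succ, h30, h13, ← h12, h02, ih]
    have h0 : ∀ i, f (i, 0) ↔ f (0, 0) := fun i => by
      have := hnat i.val
      rwa [ZMod.natCast_zmod_val] at this
    have hall : ∀ x, f x ↔ f (0, 0) := by
      rintro ⟨i, r⟩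
      fin_cases r
      · exact h0 i
      · exact (h12 i).symm.trans ((h02 i).trans (h0 i))
      · exact (h02 i).trans (h0 i)
      · exact (h13 i).trans ((h12 i).symm.trans ((h02 i).trans (h0 i)))
    intro x _ y _ hx
    exact (hall y).2 ((hall x).1 hx)
  -- The faces are the `n` monogons of the kinks and the two sides of the circle.
  faces := by
    have h := card_le_numCycles (φ := circleVertices n * circleEdges n) (circleFace n) ?_ ?_
    · simpa using h
    · rintro ⟨i, r⟩
      fin_cases r <;>
        simp [circleVertices, circleEdges, circleEdgesFun, Perm.mul_apply, circleFace]
    · rintro (i | _ | _)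
      · exact ⟨(i, 2), rfl⟩
      · exact ⟨(0, 0), rfl⟩
      · exact ⟨(0, 1), rfl⟩

/-- An average over no curves would be zero, so the lower bound needs this. -/
theorem nonempty_labelledCurve (hn : 1 ≤ n) : Nonempty (LabelledCurve n) := by
  have : NeZero n := ⟨by omega⟩
  have hc : Fintype.card (ZMod n × Fin 4) = 4 * n := by
    rw [Fintype.card_prod, ZMod.card, Fintype.card_fin, mul_comm]
  exact ⟨((isCurve_circle n).map (Fintype.equivFinOfCardEq hc)).toLabelledCurve ⟨0, by omega⟩⟩

end Example

/-! ### From labelled counts to averages over rooted curves -/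

section Average

theorem _root_.LabelledCurve.ext_of_eq {n : ℕ} {C D : LabelledCurve n} (h1 : C.σ = D.σ)
    (h2 : C.τ = D.τ) (h3 : C.root = D.root) : C = D := by
  cases C; cases D; simp_all

/-- The curve carried along a permutation of the flags. -/
def transport {n : ℕ} (C : LabelledCurve n) (g : Perm (Fin (4 * n))) : LabelledCurve n :=
  (C.isCurve.map g).toLabelledCurve (g C.root)

theorem iso_transport {n : ℕ} (C : LabelledCurve n) (g : Perm (Fin (4 * n))) :
    LabelledCurve.Iso C (transport C g) := ⟨g, rfl, rfl, rfl⟩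

/-- Relabellings with the same effect agree at the root, and their agreement spreads along `σ` and
`τ` to every flag. -/
theorem transport_injective {n : ℕ} (C : LabelledCurve n) : Function.Injective (transport C) := by
  intro g g' h
  have hσ : g.permCongr C.σ = g'.permCongr C.σ := congrArg LabelledCurve.σ h
  have hτ : g.permCongr C.τ = g'.permCongr C.τ := congrArg LabelledCurve.τ h
  have hr : g C.root = g' C.root := congrArg LabelledCurve.root h
  have key : ∀ π : Perm (Fin (4 * n)), g.permCongr π = g'.permCongr π →
      ∀ z, g (π z) = g' (π z) ↔ g z = g' z := by
    intro π hπ z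
    have h1 : g (π z) = g.permCongr π (g z) := by simp
    have h2 : g' (π z) = g.permCongr π (g' z) := by rw [hπ]; simp
    rw [h1, h2, EmbeddingLike.apply_eq_iff_eq]
  ext z
  have := C.isCurve.joined (fun z => g z = g' z)
    (fun z _ => (key C.σ hσ (C.σ z)).trans (key C.σ hσ z)) (fun z _ => key C.τ hτ z)
    C.root trivial z trivial hr
  rw [this]

noncomputable instance labelledCurveFintype (n : ℕ) : Fintype (LabelledCurve n) :=
  Fintype.ofFinite _

/-- By freeness every rooted curve has exactly `(4 n)!` labellings, so averages over rooted and over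
labelled curves coincide. -/
theorem sum_labelledCurve {n : ℕ} (f : RootedPlaneCurve n → ℝ) :
    ∑ C : LabelledCurve n, f (Quotient.mk (LabelledCurve.setoid n) C) =
      (4 * n).factorial * ∑ D, f D := by
  classical
  rw [← Finset.sum_fiberwise_of_maps_to (s := Finset.univ)
    (t := (Finset.univ : Finset (RootedPlaneCurve n)))
    (g := fun C : LabelledCurve n => (Quotient.mk (LabelledCurve.setoid n) C : RootedPlaneCurve n))
    (fun _ _ => Finset.mem_univ _), Finset.mul_sum]
  refine Finset.sum_congr rfl fun D _ => ?_
  rw [Finset.sum_congr rfl (g := fun _ => f D) (fun C hC => by rw [(Finset.mem_filter.1 hC).2]),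
    Finset.sum_const, nsmul_eq_mul]
  congr 2
  induction D using Quotient.inductionOn with
  | _ C₀ =>
    have himg : (Finset.univ.filter fun C : LabelledCurve n =>
        (Quotient.mk (LabelledCurve.setoid n) C : RootedPlaneCurve n) = Quotient.mk _ C₀) =
        Finset.univ.image (transport C₀) := by
      ext C
      simp only [Finset.mem_filter, Finset.mem_univ, true_and, Finset.mem_image]
      constructor
      · intro h
        obtain ⟨g, h1, h2, h3⟩ := (LabelledCurve.setoid n).symm (Quotient.exact h)
        exact ⟨g, LabelledCurve.ext_of_eq h1.symm h2.symm h3.symm⟩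
      · rintro ⟨g, rfl⟩
        exact Quotient.sound ((LabelledCurve.setoid n).symm (iso_transport C₀ g))
    have hcard := congrArg Finset.card himg
    rw [Finset.card_image_of_injective _ (transport_injective C₀), Finset.card_univ,
      Fintype.card_perm, Fintype.card_fin] at hcard
    convert hcard
    exact Iff.rfl

/-- A labelled curve consists of its vertices, its edges and its root. -/
def labelledCurveEquiv (n : ℕ) : LabelledCurve n ≃
    (σ : Perm (Fin (4 * n))) × {τ : Perm (Fin (4 * n)) // IsCurve n σ τ} × Fin (4 * n) where
  toFun C := ⟨C.σ, ⟨C.τ, C.isCurve⟩, C.root⟩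
  invFun x := x.2.1.2.toLabelledCurve x.2.2
  left_inv _ := rfl
  right_inv _ := rfl

theorem sum_labelledCurve_eq {n : ℕ}
    [∀ σ : Perm (Fin (4 * n)), Fintype {τ : Perm (Fin (4 * n)) // IsCurve n σ τ}]
    (f : Perm (Fin (4 * n)) → Perm (Fin (4 * n)) → ℕ) :
    ∑ C : LabelledCurve n, f C.σ C.τ =
      ∑ σ, (4 * n) * ∑ τ : {τ : Perm (Fin (4 * n)) // IsCurve n σ τ}, f σ τ := by
  rw [Fintype.sum_equiv (labelledCurveEquiv n) (fun C => f C.σ C.τ) (fun x => f x.1 x.2.1)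
    (fun C => rfl), Fintype.sum_sigma]
  refine Finset.sum_congr rfl fun σ _ => ?_
  rw [Fintype.sum_prod_type, Finset.mul_sum]
  refine Finset.sum_congr rfl fun τ _ => ?_
  simp

/-- The bound for fixed `σ` is summed over `σ`. The root is arbitrary, and a face of degree `k + 1`
is marked by at most `k + 1` flags. -/
theorem le_sum_count {n : ℕ} (k : ℕ) (hnk : 4992 * (k + 1) ≤ n) :
    4 * n * Fintype.card (LabelledCurve n) ≤
      32448 ^ (k + 1) * ((k + 1) * ∑ C : LabelledCurve n, C.faceDegrees.count (k + 1)) := by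
  classical
  have h1 := sum_labelledCurve_eq (n := n) (fun _ _ => 1)
  have h2 := sum_labelledCurve_eq (n := n) (fun σ τ => (σ * τ).partition.parts.count (k + 1))
  have h3 : ∑ C : LabelledCurve n, C.faceDegrees.count (k + 1) =
      ∑ C : LabelledCurve n, (C.σ * C.τ).partition.parts.count (k + 1) := rfl
  rw [h3, h2, ← Finset.card_univ, Finset.card_eq_sum_ones, h1, Finset.mul_sum, Finset.mul_sum,
    Finset.mul_sum]
  refine Finset.sum_le_sum fun σ _ => ?_
  have h4 := card_isCurve_le (σ := σ) (Fintype.card_fin (4 * n)) k hnk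
  have h5 : {p : Perm (Fin (4 * n)) × Fin (4 * n) | IsCurve n σ p.1 ∧
      HasSimpleFace σ p.1 (k + 1) p.2}.ncard ≤
      (k + 1) * ∑ τ : {τ : Perm (Fin (4 * n)) // IsCurve n σ τ},
        (σ * (τ : Perm (Fin (4 * n)))).partition.parts.count (k + 1) := by
    rw [Finset.mul_sum]
    have hsub : {p : Perm (Fin (4 * n)) × Fin (4 * n) | IsCurve n σ p.1 ∧
        HasSimpleFace σ p.1 (k + 1) p.2} ⊆
        (((Finset.univ : Finset {τ : Perm (Fin (4 * n)) // IsCurve n σ τ}).sigma fun τ =>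
          Finset.univ.filter fun x => Function.minimalPeriod (σ * τ.1) x = k + 1).image
          fun q => (q.1.1, q.2) : Finset (Perm (Fin (4 * n)) × Fin (4 * n))) := by
      rintro ⟨τ, b⟩ ⟨hc, hs⟩
      rw [Finset.mem_coe, Finset.mem_image]
      exact ⟨⟨⟨τ, hc⟩, b⟩, Finset.mem_sigma.2
        ⟨Finset.mem_univ _, Finset.mem_filter.2 ⟨Finset.mem_univ _, hs.1⟩⟩, rfl⟩
    refine (Set.ncard_le_ncard hsub (Finset.finite_toSet _)).trans ?_
    rw [Set.ncard_coe_finset]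
    refine Finset.card_image_le.trans ?_
    rw [Finset.card_sigma]
    exact Finset.sum_le_sum fun τ _ => (mul_count_partition _ _).ge
  have h6 : ∑ τ : {τ : Perm (Fin (4 * n)) // IsCurve n σ τ}, 1 =
      {τ : Perm (Fin (4 * n)) | IsCurve n σ τ}.ncard := by
    rw [← Finset.card_eq_sum_ones, Finset.card_univ, ← Nat.card_eq_fintype_card]
    rfl
  rw [h6]
  calc 4 * n * (4 * n * {τ : Perm (Fin (4 * n)) | IsCurve n σ τ}.ncard)
      = 4 * n * ({τ : Perm (Fin (4 * n)) | IsCurve n σ τ}.ncard * (4 * n)) := by ring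
    _ ≤ 4 * n * (32448 ^ (k + 1) * ((k + 1) * ∑ τ : {τ : Perm (Fin (4 * n)) // IsCurve n σ τ},
        (σ * (τ : Perm (Fin (4 * n)))).partition.parts.count (k + 1))) :=
      Nat.mul_le_mul_left _ (h4.trans (Nat.mul_le_mul_left _ h5))
    _ = _ := by ring

theorem _root_.RootedPlaneCurve.numFaces_eq {n : ℕ} (D : RootedPlaneCurve n) :
    D.numFaces = n + 2 := by
  induction D using Quotient.inductionOn with
  | _ C => exact C.planar

theorem _root_.RootedPlaneCurve.faceProb_eq (n k : ℕ) :
    RootedPlaneCurve.faceProb n k = RootedPlaneCurve.expectedFaceCount n k / ((n : ℝ) + 2) := by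
  rw [RootedPlaneCurve.faceProb, RootedPlaneCurve.expectedFaceCount, Finset.expect_div]
  simp [RootedPlaneCurve.numFaces_eq]

theorem _root_.RootedPlaneCurve.expectedFaceCount_eq (n k : ℕ) :
    RootedPlaneCurve.expectedFaceCount n k =
      (∑ C : LabelledCurve n, (C.faceDegrees.count k : ℝ)) / Fintype.card (LabelledCurve n) := by
  have h1 := sum_labelledCurve (n := n) fun D => (D.faceCount k : ℝ)
  have h2 := sum_labelledCurve (n := n) fun _ => 1
  have hf : ((4 * n).factorial : ℝ) ≠ 0 := by exact_mod_cast (Nat.factorial_pos _).ne'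
  rw [RootedPlaneCurve.expectedFaceCount, Fintype.expect_eq_sum_div_card,
    ← mul_div_mul_left _ _ hf]
  congr 1
  · exact h1.symm
  · simpa using h2.symm

theorem _root_.RootedPlaneCurve.le_faceProb {n : ℕ} (k : ℕ) (hnk : 4992 * (k + 1) ≤ n) :
    1 / (32448 ^ (k + 1) * ((k : ℝ) + 1)) ≤ RootedPlaneCurve.faceProb n (k + 1) := by
  have hpos : (0 : ℝ) < Fintype.card (LabelledCurve n) := by
    have := nonempty_labelledCurve n (by omega)
    exact_mod_cast Fintype.card_pos
  have h : (4 : ℝ) * n * Fintype.card (LabelledCurve n) ≤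
      32448 ^ (k + 1) *
        (((k : ℝ) + 1) * ∑ C : LabelledCurve n, (C.faceDegrees.count (k + 1) : ℝ)) := by
    exact_mod_cast le_sum_count k hnk
  have hn : (1 : ℝ) ≤ n := by
    have : 1 ≤ n := by omega
    exact_mod_cast this
  rw [RootedPlaneCurve.faceProb_eq, RootedPlaneCurve.expectedFaceCount_eq, div_div,
    div_le_div_iff₀ (by positivity) (by positivity), one_mul]
  calc (Fintype.card (LabelledCurve n) : ℝ) * (n + 2)
      ≤ Fintype.card (LabelledCurve n) * (4 * n) := by gcongr; linarith
    _ = 4 * n * Fintype.card (LabelledCurve n) := by ring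
    _ ≤ 32448 ^ (k + 1) *
        (((k : ℝ) + 1) * ∑ C : LabelledCurve n, (C.faceDegrees.count (k + 1) : ℝ)) := h
    _ = _ := by ring

theorem _root_.RootedPlaneCurve.faceProb_nonneg (n k : ℕ) : 0 ≤ RootedPlaneCurve.faceProb n k := by
  rw [RootedPlaneCurve.faceProb_eq, RootedPlaneCurve.expectedFaceCount_eq]
  positivity

theorem _root_.RootedPlaneCurve.faceProb_add_le (n : ℕ) {k l : ℕ} (hkl : k ≠ l) :
    RootedPlaneCurve.faceProb n k + RootedPlaneCurve.faceProb n l ≤ 1 := by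
  rw [RootedPlaneCurve.faceProb_eq, RootedPlaneCurve.expectedFaceCount_eq,
    RootedPlaneCurve.faceProb_eq, RootedPlaneCurve.expectedFaceCount_eq, ← add_div, ← add_div,
    ← Finset.sum_add_distrib, div_div]
  refine div_le_one_of_le₀ ?_ (by positivity)
  have hC : ∀ C : LabelledCurve n,
      (C.faceDegrees.count k : ℝ) + C.faceDegrees.count l ≤ (n : ℝ) + 2 := by
    intro C
    have h1 : C.faceDegrees.count k + C.faceDegrees.count l ≤ Multiset.card C.faceDegrees := by
      have h2 : Multiset.replicate (C.faceDegrees.count k) k +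
          Multiset.replicate (C.faceDegrees.count l) l ≤ C.faceDegrees := by
        rw [Multiset.le_iff_count]
        intro m
        rw [Multiset.count_add, Multiset.count_replicate, Multiset.count_replicate]
        by_cases e1 : k = m
        · subst e1; simp [hkl.symm]
        · by_cases e2 : l = m
          · subst e2; simp [hkl]
          · simp [e1, e2]
      simpa using Multiset.card_le_card h2
    have h3 : Multiset.card C.faceDegrees = n + 2 := C.planar
    rw [h3] at h1
    exact_mod_cast h1
  refine (Finset.sum_le_sum fun C _ => hC C).trans ?_
  rw [Finset.sum_const, Finset.card_univ, nsmul_eq_mul]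

end Average

end PlaneCurve

theorem mainTheorem5 (k : ℕ) (hk : 1 ≤ k) :
    (∀ n : ℕ, 1 ≤ n →
      ((n : ℝ) + 2) * RootedPlaneCurve.faceProb n k = RootedPlaneCurve.expectedFaceCount n k) ∧
    0 < liminf (fun n : ℕ => RootedPlaneCurve.faceProb n k) atTop ∧
    liminf (fun n : ℕ => RootedPlaneCurve.faceProb n k) atTop ≤
      limsup (fun n : ℕ => RootedPlaneCurve.faceProb n k) atTop ∧
    limsup (fun n : ℕ => RootedPlaneCurve.faceProb n k) atTop < 1 := by
  obtain ⟨j, rfl⟩ := Nat.exists_eq_add_of_le' hk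
  have hle1 : ∀ n, RootedPlaneCurve.faceProb n (j + 1) ≤ 1 := fun n => by
    have h1 := RootedPlaneCurve.faceProb_add_le n (Nat.succ_ne_self (j + 1)).symm
    have h2 := RootedPlaneCurve.faceProb_nonneg n (j + 1 + 1)
    linarith
  have hba : IsBoundedUnder (· ≤ ·) atTop (fun n : ℕ => RootedPlaneCurve.faceProb n (j + 1)) :=
    isBoundedUnder_of ⟨1, hle1⟩
  have hbb : IsBoundedUnder (· ≥ ·) atTop (fun n : ℕ => RootedPlaneCurve.faceProb n (j + 1)) :=
    isBoundedUnder_of ⟨0, fun n => RootedPlaneCurve.faceProb_nonneg n (j + 1)⟩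
  refine ⟨fun n _ => ?_, ?_, liminf_le_limsup hba hbb, ?_⟩
  · rw [RootedPlaneCurve.faceProb_eq]
    field_simp
  · refine lt_of_lt_of_le (b := 1 / (32448 ^ (j + 1) * ((j : ℝ) + 1))) (by positivity)
      (le_liminf_of_le hba.isCoboundedUnder_ge ?_)
    filter_upwards [eventually_ge_atTop (4992 * (j + 1))] with n hn
    exact RootedPlaneCurve.le_faceProb j hn
  -- The faces of the next degree already take up a positive proportion.
  · refine lt_of_le_of_lt (b := 1 - 1 / (32448 ^ (j + 1 + 1) * (((j + 1 : ℕ) : ℝ) + 1)))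
      (limsup_le_of_le hbb.isCoboundedUnder_le ?_) (sub_lt_self _ (by positivity))
    filter_upwards [eventually_ge_atTop (4992 * (j + 1 + 1))] with n hn
    have h1 := RootedPlaneCurve.faceProb_add_le n (Nat.succ_ne_self (j + 1)).symm
    have h2 := RootedPlaneCurve.le_faceProb (j + 1) hn
    linarith
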